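/- **Setting.** Let $w:[0,1]^2\to[0,1]$ be a measurable, possibly asymmetric, piecewise Lipschitz graphon: there are finitely many points $0=\alpha_0<\dots<\alpha_K=1$ and a constant $L>0$ such that, with $I_k=(\alpha_{k-1},\alpha_k)$, $$|w(x_1,y_1)-w(x_2,y_2)|\le L\,(|x_1-x_2|+|y_1-y_2|)\qquad\text{for all }(x_1,y_1),(x_2,y_2)\in I_i\times I_j,\ 1\le i,j\le K .$$ Fix $T\ge 1$. For each $n$ let $u_1,\dots,u_n$ be i.i.d. uniform labels on $[0,1]$, and, given the labels, let the entries $G_t[i,j]\in\{0,1\}$ ($1\le t\le 2T$, $1\le i,j\le n$) of $2T$ observed directed graphs be independent with $\Pr(G_t[i,j]=1\mid u)=w(u_i,u_j)$. **Estimator.** For each pair $i\ne j$ let $\mathcal S_{ij}\subseteq\{1,\dots,n\}\setminus\{i,j\}$ be a set of $S=S_n$ vertices (a neighborhood), chosen deterministically or at random independently of the labels and graphs. Put $$\hat c_{ij}^{\,k}=\frac1{T^2}\Big(\sum_{1\le t\le T}G_t[k,i]\Big)\Big(\sum_{T<t\le 2T}G_t[k,j]\Big),\qquad \hat r_{ij}^{\,k}=\frac1{T^2}\Big(\sum_{1\le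 t\le T}G_t[i,k]\Big)\Big(\sum_{T<t\le 2T}G_t[j,k]\Big),$$ $$\hat d_{ij}=\frac12\cdot\frac1{S}\sum_{k\in\mathcal S_{ij}}\Big\{(\hat r_{ii}^{\,k}-\hat r_{ij}^{\,k}-\hat r_{ji}^{\,k}+\hat r_{jj}^{\,k})+(\hat c_{ii}^{\,k}-\hat c_{ij}^{\,k}-\hat c_{ji}^{\,k}+\hat c_{jj}^{\,k})\Big\}.$$ Given a precision $\Delta=\Delta_n>0$, the SBA algorithm starts with $R=\{1,\dots,n\}$; as long as $R\neq\emptyset$ it picks at random a pivot $p\in R$ (uniformly, or by any other random mechanism), outputs the block consisting of $p$ and of all other $v\in R$ with $\hat d_{p,v}\le\Delta^2$, and removes this block from $R$. Writing $\hat B_i$ for the block that contains vertex $i$, the estimator is $$\hat w(u_i,u_j)=\frac1{|\hat B_i|\,|\hat B_j|}\sum_{x\in\hat B_i}\sum_{y\in\hat B_j}\frac1{2T}\sum_{t=1}^{2T}G_t[x,y].$$ Its mean absolute and mean squared errors are $$\mathrm{MAE}(\hat w)=\frac1{n^2}\sum_{i,j=1}^n|w(u_i,u_j)-\hat w(u_i,u_j)|,\qquad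 \mathrm{MSE}(\hat w)=\frac1{n^2}\sum_{i,j=1}^n\big(w(u_i,u_j)-\hat w(u_i,u_j)\big)^2 .$$ **Theorem.** If $S_n=\Theta(n)$, $\Delta_n=\omega\big((\log n/n)^{1/4}\big)$ and $\Delta_n=o(1)$, then $$\lim_{n\to\infty}\mathbb E[\mathrm{MAE}(\hat w)]=0\qquad\text{and}\qquad\lim_{n\to\infty}\mathbb E[\mathrm{MSE}(\hat w)]=0 .$$ -/

import Mathlib

open MeasureTheory ProbabilityTheory Filter Asymptotics Topology unitInterval
open scoped ENNReal

namespace SBA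

/-- `w` is piecewise Lipschitz: there are finitely many break points `0 = α₀ < ⋯ < α_K = 1` and a
constant `L > 0` such that `w` is `L`-Lipschitz for the `ℓ¹` distance on every rectangle
`I_i × I_j`, where `I_k` is the interval between `α_{k-1}` and `α_k`. The intervals are taken open,
so nothing is required of `w` on the finitely many break lines; this holds a fortiori under any
other convention about the end points, and it includes the piecewise constant graphons
(stochastic block models). -/
def IsPiecewiseLipschitz (w : I → I → I) : Prop :=
  ∃ (K : ℕ) (α : Fin (K + 1) → I) (L : ℝ),
    StrictMono α ∧ α 0 = 0 ∧ α (Fin.last K) = 1 ∧ 0 < L ∧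
    ∀ i j : Fin K,
      ∀ x₁ ∈ Set.Ioo (α i.castSucc) (α i.succ), ∀ x₂ ∈ Set.Ioo (α i.castSucc) (α i.succ),
      ∀ y₁ ∈ Set.Ioo (α j.castSucc) (α j.succ), ∀ y₂ ∈ Set.Ioo (α j.castSucc) (α j.succ),
        |(w x₁ y₁ : ℝ) - (w x₂ y₂ : ℝ)|
          ≤ L * (|(x₁ : ℝ) - (x₂ : ℝ)| + |(y₁ : ℝ) - (y₂ : ℝ)|)

/-- The adjacency matrices of `2T` directed graphs on the vertex set `{0, …, n-1}`:
`G t i j` says whether `i → j` is an edge of the `t`-th graph. The indices `t < T` are the first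
half of the observations, the indices `t ≥ T` the second half. -/
abbrev Obs (n T : ℕ) : Type := Fin (2 * T) → Fin n → Fin n → Bool

/-- The entry `0` or `1` of an adjacency matrix. -/
def entry (b : Bool) : ℝ := if b then 1 else 0

/-- The mass that the Bernoulli distribution with parameter `p` gives to `b`. -/
noncomputable def bernoulliMass (p : I) (b : Bool) : ℝ≥0∞ :=
  ENNReal.ofReal (if b then (p : ℝ) else 1 - (p : ℝ))

/-- `u` and `G` are the vertex labels and the `2T` observed directed graphs drawn from the
graphon `w`: the labels are i.i.d. uniform on `[0,1]`, and given the labels, all the entries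
`G_t[i,j]` are independent, `G_t[i,j]` being Bernoulli with parameter `w (u_i) (u_j)`.
Here `volume` on `Fin n → I` is the `n`-fold product of the uniform distribution on `[0,1]`. -/
structure IsGraphonSample (w : I → I → I) {n T : ℕ} {Ω : Type*} [MeasurableSpace Ω]
    (P : Measure Ω) (u : Ω → Fin n → I) (G : Ω → Obs n T) : Prop where
  measurable_label : Measurable u
  measurable_graph : Measurable G
  joint_law : ∀ (A : Set (Fin n → I)) (g : Obs n T), MeasurableSet A →
    P {ω | u ω ∈ A ∧ G ω = g} =
      ∫⁻ x in A, ∏ t : Fin (2 * T), ∏ i : Fin n, ∏ j : Fin n,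
        bernoulliMass (w (x i) (x j)) (g t i j)

/-- `r̂_{ij}^k`. -/
noncomputable def rHat {n T : ℕ} (G : Obs n T) (k i j : Fin n) : ℝ :=
  1 / (T : ℝ) ^ 2 * (∑ t : Fin (2 * T) with t.val < T, entry (G t i k))
    * (∑ t : Fin (2 * T) with T ≤ t.val, entry (G t j k))

/-- `ĉ_{ij}^k`. -/
noncomputable def cHat {n T : ℕ} (G : Obs n T) (k i j : Fin n) : ℝ :=
  1 / (T : ℝ) ^ 2 * (∑ t : Fin (2 * T) with t.val < T, entry (G t k i))
    * (∑ t : Fin (2 * T) with T ≤ t.val, entry (G t k j))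

/-- The estimated distance `d̂_{ij}` between the slices of vertices `i` and `j`, computed from the
neighborhoods `N i j` of summation indices. -/
noncomputable def dHat {n T : ℕ} (G : Obs n T) (N : Fin n → Fin n → Finset (Fin n))
    (i j : Fin n) : ℝ :=
  1 / 2 * (1 / ((N i j).card : ℝ) * ∑ k ∈ N i j,
    ((rHat G k i i - rHat G k i j - rHat G k j i + rHat G k j j)
      + (cHat G k i i - cHat G k i j - cHat G k j i + cHat G k j j)))

/-- `N` is a choice of neighborhoods of size `S`: for every pair `i ≠ j` a set `N i j` of `S`
vertices other than `i` and `j`. It may be random, but does not depend on the data. -/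
structure IsNeighborhoodChoice (S : ℕ) {n T : ℕ} {Ω : Type*} [MeasurableSpace Ω]
    (P : Measure Ω) (u : Ω → Fin n → I) (G : Ω → Obs n T)
    (N : Ω → Fin n → Fin n → Finset (Fin n)) : Prop where
  measurable_nbhd : Measurable N
  indep : IndepFun N (fun ω => (u ω, G ω)) P
  subset : ∀ ω, ∀ i j : Fin n, i ≠ j → i ∉ N ω i j ∧ j ∉ N ω i j
  card_eq : ∀ ω, ∀ i j : Fin n, i ≠ j → (N ω i j).card = S

/-- The block opened with pivot `p` while the set `R` of vertices is still unassigned: the pivot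
and all other vertices `v` of `R` with `d p v ≤ Δ²`. -/
noncomputable def pivotBlock {V : Type*} [DecidableEq V] (d : V → V → ℝ) (Δ : ℝ)
    (R : Finset V) (p : V) : Finset V := by
  classical exact R.filter fun v => v = p ∨ d p v ≤ Δ ^ 2

/-- `IsGreedyRun d Δ R B`: the list `B` of blocks is a possible output of the greedy clustering,
started with the set `R` of unassigned vertices. As long as `R` is not empty, some pivot in `R` is
picked, its block is put out and removed from `R`. -/
inductive IsGreedyRun {V : Type*} [DecidableEq V] (d : V → V → ℝ) (Δ : ℝ) :
    Finset V → List (Finset V) → Prop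
  | done : IsGreedyRun d Δ ∅ []
  | step (R : Finset V) (p : V) (hp : p ∈ R) (B : List (Finset V))
      (hB : IsGreedyRun d Δ (R \ pivotBlock d Δ R p) B) :
      IsGreedyRun d Δ R (pivotBlock d Δ R p :: B)

/-- `B` is the random list of blocks put out by the clustering of all vertices, with the distance
estimates `d̂` and precision `Δ`. No restriction is put on the mechanism that picks the pivots: any
random choice (uniform among the unassigned vertices, or other) is allowed. -/
structure IsRandomGreedyOutput (Δ : ℝ) {n T : ℕ} {Ω : Type*} [MeasurableSpace Ω]
    (G : Ω → Obs n T) (N : Ω → Fin n → Fin n → Finset (Fin n))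
    (B : Ω → List (Finset (Fin n))) : Prop where
  measurableSet_eq : ∀ l : List (Finset (Fin n)), MeasurableSet {ω | B ω = l}
  run : ∀ ω, IsGreedyRun (dHat (G ω) (N ω)) Δ Finset.univ (B ω)

/-- The block of the list `B` that contains the vertex `i`. -/
def blockOf {V : Type*} [DecidableEq V] (B : List (Finset V)) (i : V) : Finset V :=
  (B.find? fun b => decide (i ∈ b)).getD ∅

/-- The estimate `ŵ(u_i, u_j)`: the frequency, over all `2T` graphs, of the edges from the block of
`i` to the block of `j`. -/
noncomputable def wHat {n T : ℕ} (G : Obs n T) (B : List (Finset (Fin n))) (i j : Fin n) : ℝ :=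
  1 / (((blockOf B i).card : ℝ) * ((blockOf B j).card : ℝ)) *
    ∑ x ∈ blockOf B i, ∑ y ∈ blockOf B j, 1 / (2 * (T : ℝ)) * ∑ t, entry (G t x y)

/-- Mean absolute error over all ordered pairs of vertices. -/
noncomputable def mae (w : I → I → I) {n T : ℕ} (u : Fin n → I) (G : Obs n T)
    (B : List (Finset (Fin n))) : ℝ :=
  1 / (n : ℝ) ^ 2 * ∑ i : Fin n, ∑ j : Fin n, |(w (u i) (u j) : ℝ) - wHat G B i j|

/-- Mean squared error over all ordered pairs of vertices. -/
noncomputable def mse (w : I → I → I) {n T : ℕ} (u : Fin n → I) (G : Obs n T)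
    (B : List (Finset (Fin n))) : ℝ :=
  1 / (n : ℝ) ^ 2 * ∑ i : Fin n, ∑ j : Fin n, ((w (u i) (u j) : ℝ) - wHat G B i j) ^ 2

end SBA

/-! Given the labels, all edges are independent, and Hoeffding's inequality gives three facts that
hold together with probability tending to 1. (1) Every `dHat` is within Δ²/2 of its mean
`sliceDist`, the mean squared distance of two slices; the union bound costs n² exp(-c n Δ⁴), which
vanishes because nΔ⁴ outgrows log n. (2) Every neighborhood has its share of labels in each cell of
a fixed finite partition. (3) For all 4ⁿ pairs of vertex sets, the edge count deviates from its mean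
by at most order n^(3/2). Uniformity in (3) is needed because the blocks depend on the observed
edges.

The rest is deterministic (`LipschitzOnPieces.mae_le`). Two vertices with labels in one cell of
width Δ/(2L) satisfy `dHat` ≤ Δ², so they are never both pivots, and there are O(1/Δ) blocks
(`IsGreedyRun.length_le_card_image`). Conversely, a vertex is within `sliceDist` ≤ 3Δ²/2 of its
pivot. Slices that differ by more than η at one point differ by at least η/2 on a whole cell of
positive mass, so a small `sliceDist` forces uniform closeness
(`LipschitzOnPieces.abs_sub_le_of_sliceDist_le`), and the bias is at most 4η. The noise of a pair of
vertices is divided by the sizes of both blocks; these weights sum to at most the squared number of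
blocks, so the noise contributes O(n^(-1/2) Δ^(-2)), which vanishes.

All errors lie in [0,1], so convergence in probability gives convergence in mean, and MSE ≤ MAE. -/

namespace SBA

/-! ### Hoeffding's inequality and grouping of independent families -/

section Independence

variable {Ω : Type*} [MeasurableSpace Ω] {μ : Measure Ω}

/-- Two-sided **Hoeffding inequality** for independent variables with values in `[a, b]`. -/
theorem measure_abs_sum_sub_integral_ge_le {ι : Type*} [IsProbabilityMeasure μ]
    {X : ι → Ω → ℝ} (hX : iIndepFun X μ) (hm : ∀ i, Measurable (X i)) {a b : ℝ}
    (hab : ∀ i ω, X i ω ∈ Set.Icc a b) (s : Finset ι) {m : ℝ} (hm0 : 0 < m) (hs : s.card ≤ m)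
    (hlt : a < b) {ε : ℝ} (hε : 0 ≤ ε) :
    μ {ω | ε ≤ |∑ i ∈ s, (X i ω - ∫ ω', X i ω' ∂μ)|} ≤
      ENNReal.ofReal (2 * Real.exp (-2 * ε ^ 2 / (m * (b - a) ^ 2))) := by
  have hind : iIndepFun (fun i ω => X i ω - ∫ ω', X i ω' ∂μ) μ :=
    hX.comp (fun i x => x - ∫ ω', X i ω' ∂μ) (fun i => by fun_prop)
  have hsub : ∀ i ∈ s, HasSubgaussianMGF (fun ω => X i ω - ∫ ω', X i ω' ∂μ)
      ((‖b - a‖₊ / 2) ^ 2) μ := fun i _ =>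
    hasSubgaussianMGF_of_mem_Icc (hm i).aemeasurable (ae_of_all _ (hab i))
  have hsum := HasSubgaussianMGF.sum_of_iIndepFun hind hsub
  have hba : 0 < b - a := sub_pos.2 hlt
  have hc : ((∑ i ∈ s, (‖b - a‖₊ / 2) ^ 2 : NNReal) : ℝ) ≤ m * (b - a) ^ 2 / 4 := by
    push_cast
    rw [Finset.sum_const, nsmul_eq_mul, Real.norm_of_nonneg hba.le]
    have := mul_le_mul_of_nonneg_right hs (sq_nonneg (b - a))
    linarith
  have key : ∀ Y : Ω → ℝ, HasSubgaussianMGF Y (∑ i ∈ s, (‖b - a‖₊ / 2) ^ 2) μ →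
      μ {ω | ε ≤ Y ω} ≤ ENNReal.ofReal (Real.exp (-2 * ε ^ 2 / (m * (b - a) ^ 2))) := by
    intro Y hY
    rw [← ofReal_measureReal]
    refine ENNReal.ofReal_le_ofReal ?_
    -- For an empty sum the sub-Gaussian parameter is 0 and the tail bound degenerates; the variable
    -- is then a.e. zero.
    rcases s.eq_empty_or_nonempty with h | h
    · subst h
      simp only [Finset.sum_empty] at hY
      rcases hε.eq_or_lt with h0 | h0
      · subst h0; simp
      · have h1 : {ω | ε ≤ Y ω} ⊆ {ω | ¬ Y ω = 0} := fun ω hω h => by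
          simp only [Set.mem_ofPred_eq] at hω; linarith
        have h2 : μ {ω | ε ≤ Y ω} = 0 := measure_mono_null h1 hY.ae_eq_zero_of_hasSubgaussianMGF_zero
        simp only [measureReal_def, h2, ENNReal.toReal_zero]
        positivity
    · refine (hY.measure_ge_le hε).trans (Real.exp_le_exp.2 ?_)
      have hpos : 0 < ((∑ i ∈ s, (‖b - a‖₊ / 2) ^ 2 : NNReal) : ℝ) := by
        push_cast
        rw [Finset.sum_const, nsmul_eq_mul, Real.norm_of_nonneg hba.le]
        have : 0 < s.card := h.card_pos
        positivity
      rw [neg_div, neg_mul, neg_div, neg_le_neg_iff, div_le_div_iff₀ (by positivity) (by positivity)]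
      nlinarith [sq_nonneg ε, mul_le_mul_of_nonneg_left hc (sq_nonneg ε)]
  have hsub2 : {ω | ε ≤ |∑ i ∈ s, (X i ω - ∫ ω', X i ω' ∂μ)|} ⊆
      {ω | ε ≤ ∑ i ∈ s, (X i ω - ∫ ω', X i ω' ∂μ)} ∪
      {ω | ε ≤ (-fun ω => ∑ i ∈ s, (X i ω - ∫ ω', X i ω' ∂μ)) ω} := by
    intro ω hω
    simpa [le_abs] using hω
  refine (measure_mono hsub2).trans ((measure_union_le _ _).trans ?_)
  rw [two_mul, ENNReal.ofReal_add (by positivity) (by positivity)]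
  exact add_le_add (key _ hsum) (key _ hsum.neg)

/-- Grouping an independent family gives an independent family of vectors. -/
theorem iIndepFun_curry {ι κ β : Type*} [MeasurableSpace β]
    {X : ι → κ → Ω → β} (mX : ∀ i j, Measurable (X i j))
    (h : iIndepFun (fun (p : ι × κ) ω => X p.1 p.2 ω) μ) :
    iIndepFun (fun i ω j => X i j ω) μ := by
  have := h.isProbabilityMeasure
  have hp : ∀ i j, IsProbabilityMeasure (μ.map (X i j)) :=
    fun i j => Measure.isProbabilityMeasure_map (mX i j).aemeasurable
  have h' : iIndepFun (fun (p : (_ : ι) × κ) ω => X p.1 p.2 ω) μ :=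
    h.precomp (g := fun p : (_ : ι) × κ => (p.1, p.2)) (Equiv.sigmaEquivProd ι κ).injective
  rw [iIndepFun_iff_map_fun_eq_infinitePi_map (by fun_prop)] at h'
  rw [iIndepFun_iff_map_fun_eq_infinitePi_map (by fun_prop)]
  have e : (MeasurableEquiv.piCurry (fun (_ : ι) (_ : κ) => β)) ∘
      (fun ω (p : (_ : ι) × κ) => X p.1 p.2 ω) = fun ω i j => X i j ω := by
    ext; simp [Sigma.curry]
  rw [← e, ← Measure.map_map (by fun_prop) (by fun_prop), h',
    Measure.infinitePi_map_piCurry (fun i j => μ.map (X i j))]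
  congr 1
  funext i
  exact (h.precomp (g := fun j : κ => (i, j))
    (Prod.mk_right_injective i)).map_fun_eq_infinitePi_map (mX i) |>.symm

end Independence

/-! ### The law of the edges given the labels -/

/-- The Bernoulli distribution on `Bool`. -/
noncomputable def bernoulliLaw (p : I) : Measure Bool :=
  bernoulliMass p true • Measure.dirac true + bernoulliMass p false • Measure.dirac false

theorem bernoulliLaw_singleton (p : I) (b : Bool) :
    bernoulliLaw p {b} = bernoulliMass p b := by
  cases b <;> simp [bernoulliLaw]

instance (p : I) : IsProbabilityMeasure (bernoulliLaw p) := ⟨by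
  simp only [bernoulliLaw, Measure.coe_add, Measure.coe_smul, Pi.add_apply, Pi.smul_apply,
    measure_univ, smul_eq_mul, mul_one, bernoulliMass]
  rw [← ENNReal.ofReal_add] <;> simp [p.2.1, p.2.2]⟩

theorem entry_mem (b : Bool) : entry b ∈ Set.Icc (0 : ℝ) 1 := by
  cases b <;> simp [entry]

theorem measurable_entry : Measurable entry := measurable_of_countable _

theorem integral_entry_bernoulliLaw (p : I) : ∫ b, entry b ∂(bernoulliLaw p) = p := by
  rw [integral_fintype (.of_finite)]
  simp [measureReal_def, bernoulliLaw_singleton, bernoulliMass, entry, p.2.1]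

/-- The joint law of all adjacency entries when the edge probabilities are `p i j`. -/
noncomputable def edgeLaw (T : ℕ) {n : ℕ} (p : Fin n → Fin n → I) :
    Measure (Fin (2 * T) × Fin n × Fin n → Bool) :=
  Measure.pi fun c => bernoulliLaw (p c.2.1 c.2.2)

instance (T : ℕ) {n : ℕ} (p : Fin n → Fin n → I) : IsProbabilityMeasure (edgeLaw T p) := by
  unfold edgeLaw; infer_instance

/-- The adjacency matrices with given entries. -/
def toObs {n T : ℕ} : (Fin (2 * T) × Fin n × Fin n → Bool) ≃ Obs n T where
  toFun g t i j := g (t, i, j)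
  invFun g c := g c.1 c.2.1 c.2.2

theorem edgeLaw_singleton {n T : ℕ} (p : Fin n → Fin n → I) (g : Obs n T) :
    edgeLaw T p {toObs.symm g} = ∏ t, ∏ i, ∏ j, bernoulliMass (p i j) (g t i j) := by
  rw [edgeLaw, Measure.pi_singleton]
  simp only [bernoulliLaw_singleton, Fintype.prod_prod_type]
  rfl

theorem iIndepFun_entry {n T : ℕ} (p : Fin n → Fin n → I) :
    iIndepFun (fun (c : Fin (2 * T) × Fin n × Fin n) ω => entry (ω c)) (edgeLaw T p) :=
  iIndepFun_pi fun _ => measurable_entry.aemeasurable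

theorem integral_entry {n T : ℕ} (p : Fin n → Fin n → I) (c : Fin (2 * T) × Fin n × Fin n) :
    ∫ ω, entry (ω c) ∂(edgeLaw T p) = p c.2.1 c.2.2 := by
  rw [← integral_entry_bernoulliLaw]
  exact integral_comp_eval (μ := fun c : Fin (2 * T) × Fin n × Fin n =>
    bernoulliLaw (p c.2.1 c.2.2)) (i := c) (f := entry)
    measurable_entry.aestronglyMeasurable

theorem measurable_bernoulliMass (b : Bool) : Measurable fun p : I => bernoulliMass p b := by
  unfold bernoulliMass
  cases b <;> simp <;> fun_prop

theorem measurable_graphon_label {w : I → I → I} (hw : Measurable (Function.uncurry w)) {n : ℕ}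
    (i j : Fin n) : Measurable fun x : Fin n → I => w (x i) (x j) := by
  have h : Measurable fun x : Fin n → I => (x i, x j) := by fun_prop
  exact hw.comp h

/-! ### Conditioning on labels and on neighborhoods -/

section Transfer

variable {w : I → I → I} {n T : ℕ} {Ω : Type*} [MeasurableSpace Ω] {P : Measure Ω}
  {u : Ω → Fin n → I} {G : Ω → Obs n T}

/-- Probabilities about labels and graphs are obtained by conditioning on the labels. -/
theorem IsGraphonSample.measure_le_lintegral (hw : Measurable (Function.uncurry w))
    (h : IsGraphonSample w P u G) (E : Set ((Fin n → I) × Obs n T))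
    (hE : ∀ g, MeasurableSet {x | (x, g) ∈ E}) :
    P {ω | (u ω, G ω) ∈ E} ≤
      ∫⁻ x, edgeLaw T (fun i j => w (x i) (x j)) {ω | (x, toObs ω) ∈ E} := by
  classical
  have h1 : {ω | (u ω, G ω) ∈ E} = ⋃ g, {ω | u ω ∈ {x | (x, g) ∈ E} ∧ G ω = g} := by
    ext ω; simp
  rw [h1]
  refine (measure_iUnion_fintype_le P _).trans (le_of_eq ?_)
  simp_rw [h.joint_law _ _ (hE _)]
  simp_rw [← lintegral_indicator (hE _)]
  have hmeas : ∀ g : Obs n T, Measurable fun x : Fin n → I =>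
      ∏ t : Fin (2 * T), ∏ i : Fin n, ∏ j : Fin n,
        bernoulliMass (w (x i) (x j)) (g t i j) := by
    intro g
    refine Finset.measurable_prod _ fun t _ => Finset.measurable_prod _ fun i _ =>
      Finset.measurable_prod _ fun j _ => (measurable_bernoulliMass _).comp (measurable_graphon_label hw i j)
  rw [← lintegral_finsetSum _ fun g _ => (hmeas g).indicator (hE g)]
  refine lintegral_congr fun x => ?_
  rw [← Measure.tsum_indicator_apply_singleton _ _ (Set.toFinite _).measurableSet, tsum_fintype,
    ← toObs.symm.sum_comp]
  refine Finset.sum_congr rfl fun g _ => ?_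
  by_cases hg : (x, g) ∈ E
  · rw [Set.indicator_of_mem (by exact hg), Set.indicator_of_mem (by simpa using hg),
      edgeLaw_singleton]
  · rw [Set.indicator_of_notMem (by exact hg), Set.indicator_of_notMem (by simpa using hg)]

theorem IsGraphonSample.measure_le (hw : Measurable (Function.uncurry w))
    (h : IsGraphonSample w P u G) (E : Set ((Fin n → I) × Obs n T))
    (hE : ∀ g, MeasurableSet {x | (x, g) ∈ E}) {c : ℝ≥0∞}
    (hc : ∀ x : Fin n → I,
      edgeLaw T (fun i j => w (x i) (x j)) {ω | (x, toObs ω) ∈ E} ≤ c) :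
    P {ω | (u ω, G ω) ∈ E} ≤ c :=
  (h.measure_le_lintegral hw E hE).trans ((lintegral_mono hc).trans (by simp))

theorem IsGraphonSample.measure_label_le (hw : Measurable (Function.uncurry w))
    (h : IsGraphonSample w P u G) (A : Set (Fin n → I)) (hA : MeasurableSet A) :
    P {ω | u ω ∈ A} ≤ volume A := by
  refine (h.measure_le_lintegral hw {z | z.1 ∈ A} fun _ => hA).trans ?_
  rw [← lintegral_indicator_one hA]
  refine lintegral_mono fun x => ?_
  by_cases hx : x ∈ A <;> simp [hx]

theorem measurableSet_of_sections {E : Set ((Fin n → I) × Obs n T)}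
    (hE : ∀ g, MeasurableSet {x | (x, g) ∈ E}) : MeasurableSet E := by
  have : E = ⋃ g, {x | (x, g) ∈ E} ×ˢ {g} := by
    ext ⟨x, g⟩; simp
  rw [this]
  exact MeasurableSet.iUnion fun g => (hE g).prod (measurableSet_singleton g)

/-- A bound valid for each admissible choice of neighborhoods holds for random neighborhoods. -/
theorem IsNeighborhoodChoice.measure_le [IsProbabilityMeasure P] {S : ℕ}
    {N : Ω → Fin n → Fin n → Finset (Fin n)} (h : IsNeighborhoodChoice S P u G N)
    (E : (Fin n → Fin n → Finset (Fin n)) → Set ((Fin n → I) × Obs n T))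
    (hE : ∀ ν g, MeasurableSet {x | (x, g) ∈ E ν}) {c : ℝ≥0∞}
    (hc : ∀ ν : Fin n → Fin n → Finset (Fin n),
      (∀ i j, i ≠ j → i ∉ ν i j ∧ j ∉ ν i j) → (∀ i j, i ≠ j → (ν i j).card = S) →
      P {ω | (u ω, G ω) ∈ E ν} ≤ c) :
    P {ω | (u ω, G ω) ∈ E (N ω)} ≤ c := by
  have h1 : {ω | (u ω, G ω) ∈ E (N ω)} =
      ⋃ ν, N ⁻¹' {ν} ∩ (fun ω => (u ω, G ω)) ⁻¹' E ν := by
    ext ω; simp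
  rw [h1]
  refine (measure_iUnion_fintype_le P _).trans ?_
  have h2 : ∀ ν, P (N ⁻¹' {ν} ∩ (fun ω => (u ω, G ω)) ⁻¹' E ν) ≤ P (N ⁻¹' {ν}) * c := by
    intro ν
    rw [h.indep.measure_inter_preimage_eq_mul _ _ (measurableSet_singleton ν)
      (measurableSet_of_sections (hE ν))]
    rcases (N ⁻¹' {ν}).eq_empty_or_nonempty with h0 | ⟨ω, rfl⟩
    · simp [h0]
    · exact mul_le_mul_right (hc _ (h.subset ω) (h.card_eq ω)) _
  refine (Finset.sum_le_sum fun ν _ => h2 ν).trans ?_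
  rw [← Finset.sum_mul]
  have h3 : ∑ ν, P (N ⁻¹' {ν}) = 1 := by
    rw [sum_measure_preimage_singleton _ fun ν _ => h.measurable_nbhd (measurableSet_singleton ν)]
    simp
  simp [h3]

end Transfer

/-! ### Concentration of edge counts, label counts and distances -/

/-- Concentration of the number of edges between two sets of vertices. -/
theorem edgeLaw_abs_sum_ge_le {n T : ℕ} (hn : 0 < n) (hT : 0 < T) (p : Fin n → Fin n → I)
    (A A' : Finset (Fin n)) {τ : ℝ} (hτ : 0 ≤ τ) :
    edgeLaw T p {ω | τ ≤ |∑ i ∈ A, ∑ j ∈ A', ∑ t, (entry (toObs ω t i j) - (p i j : ℝ))|} ≤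
      ENNReal.ofReal (2 * Real.exp (-τ ^ 2 / (T * (n : ℝ) ^ 2))) := by
  have hT' : (0 : ℝ) < T := by exact_mod_cast hT
  have hn' : (0 : ℝ) < n := by exact_mod_cast hn
  -- The number of summands is bounded by 2Tn² whatever the two sets are, so the estimate is uniform
  -- in them.
  have h := measure_abs_sum_sub_integral_ge_le (iIndepFun_entry (T := T) p)
    (fun c => measurable_entry.comp (measurable_pi_apply c)) (a := 0) (b := 1)
    (fun c ω => entry_mem _) ((Finset.univ : Finset (Fin (2 * T))) ×ˢ (A ×ˢ A'))
    (m := 2 * T * (n : ℝ) ^ 2) (by positivity) ?_ one_pos hτ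
  · convert h using 3
    · ext ω
      congr! 2
      rw [Finset.sum_product_right, Finset.sum_product]
      simp only [integral_entry]
      rfl
    · congr 1
      field_simp
      ring
  · rw [Finset.card_product, Finset.card_product, Finset.card_univ, Fintype.card_fin]
    push_cast
    have h1 : (A.card : ℝ) ≤ n := by exact_mod_cast card_finset_fin_le A
    have h2 : (A'.card : ℝ) ≤ n := by exact_mod_cast card_finset_fin_le A'
    have := mul_le_mul h1 h2 (by positivity) (by positivity)
    rw [sq]
    exact mul_le_mul_of_nonneg_left this (by positivity)

/-- Concentration of the number of labels in a given set. -/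
theorem volume_card_filter_le {n : ℕ} (N : Finset (Fin n)) (hN : 0 < N.card) {Q : Set I}
    (hQ : MeasurableSet Q) {m₀ : ℝ} (hm₀ : 0 ≤ m₀) (hm : m₀ ≤ volume.real Q) :
    (volume : Measure (Fin n → I)) {x | ∑ k ∈ N, Q.indicator 1 (x k) ≤ N.card * m₀ / 2} ≤
      ENNReal.ofReal (2 * Real.exp (-(N.card * m₀ ^ 2 / 2))) := by
  have hS : (0 : ℝ) < N.card := by exact_mod_cast hN
  have hf : Measurable (Q.indicator (1 : I → ℝ)) := measurable_one.indicator hQ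
  have hind : iIndepFun (fun k (x : Fin n → I) => Q.indicator (1 : I → ℝ) (x k)) volume := by
    rw [volume_pi]
    exact iIndepFun_pi fun _ => hf.aemeasurable
  have hint : ∀ k, ∫ x : Fin n → I, Q.indicator (1 : I → ℝ) (x k) = volume.real Q := by
    intro k
    rw [volume_pi, integral_comp_eval (μ := fun _ : Fin n => (volume : Measure I)) (i := k)
      (f := Q.indicator (1 : I → ℝ)) hf.aestronglyMeasurable, integral_indicator_one hQ]
  -- The mean count is at least |N| m₀, so a count of at most half of that is a deviation of |N| m₀
  -- / 2.
  have h := measure_abs_sum_sub_integral_ge_le hind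
    (fun k => hf.comp (measurable_pi_apply k)) (a := 0) (b := 1)
    (fun k x => by by_cases hx : x k ∈ Q <;> simp [hx]) N (m := N.card) hS le_rfl
    one_pos (ε := N.card * m₀ / 2) (by positivity)
  simp only [hint] at h
  refine (measure_mono fun x hx => ?_).trans (h.trans_eq ?_)
  · simp only [Set.mem_ofPred_eq] at hx ⊢
    rw [Finset.sum_sub_distrib, Finset.sum_const, nsmul_eq_mul]
    refine le_trans ?_ (neg_le_abs _)
    nlinarith [mul_le_mul_of_nonneg_left hm hS.le]
  · congr 3
    field_simp
    ring

/-- The contribution of vertex `k` to the estimated distance between `i` and `j`. -/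
noncomputable def sliceStat {n T : ℕ} (g : Obs n T) (i j k : Fin n) : ℝ :=
  1 / (T : ℝ) ^ 2 * (∑ t : Fin (2 * T) with t.val < T, (entry (g t i k) - entry (g t j k)))
    * (∑ t : Fin (2 * T) with T ≤ t.val, (entry (g t i k) - entry (g t j k)))
  + 1 / (T : ℝ) ^ 2 * (∑ t : Fin (2 * T) with t.val < T, (entry (g t k i) - entry (g t k j)))
    * (∑ t : Fin (2 * T) with T ≤ t.val, (entry (g t k i) - entry (g t k j)))

/-- By bilinearity the four terms factor into a first-half difference times a second-half
difference. -/
theorem dHat_eq_sum_sliceStat {n T : ℕ} (g : Obs n T) (N : Fin n → Fin n → Finset (Fin n))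
    (i j : Fin n) :
    dHat g N i j = 1 / 2 * (1 / ((N i j).card : ℝ) * ∑ k ∈ N i j, sliceStat g i j k) := by
  unfold dHat
  congr 2
  refine Finset.sum_congr rfl fun k _ => ?_
  simp only [rHat, cHat, sliceStat, Finset.sum_sub_distrib]
  ring

/-- The expectation of `dHat` given the edge probabilities. -/
noncomputable def sliceDist {n : ℕ} (p : Fin n → Fin n → I) (N : Fin n → Fin n → Finset (Fin n))
    (i j : Fin n) : ℝ :=
  1 / 2 * (1 / ((N i j).card : ℝ) * ∑ k ∈ N i j,
    (((p i k : ℝ) - p j k) ^ 2 + ((p k i : ℝ) - p k j) ^ 2))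

theorem card_filter_lt (T : ℕ) : (Finset.univ.filter fun t : Fin (2 * T) => t.val < T).card = T := by
  rw [Fin.card_filter_val_lt]; omega

theorem card_filter_ge (T : ℕ) : (Finset.univ.filter fun t : Fin (2 * T) => T ≤ t.val).card = T := by
  have h := Finset.card_filter_add_card_filter_not (s := (Finset.univ : Finset (Fin (2 * T))))
    (fun t : Fin (2 * T) => t.val < T)
  simp only [card_filter_lt, not_lt, Finset.card_univ, Fintype.card_fin] at h
  omega

theorem abs_half_mul_half_le {T : ℕ} (hT : 0 < T) {a : Fin (2 * T) → ℝ} (ha : ∀ t, |a t| ≤ 1) :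
    |1 / (T : ℝ) ^ 2 * (∑ t : Fin (2 * T) with t.val < T, a t)
      * (∑ t : Fin (2 * T) with T ≤ t.val, a t)| ≤ 1 := by
  have hT' : (0 : ℝ) < T := by exact_mod_cast hT
  have h1 : |∑ t : Fin (2 * T) with t.val < T, a t| ≤ T := by
    refine (Finset.abs_sum_le_sum_abs _ _).trans ((Finset.sum_le_sum fun t _ => ha t).trans ?_)
    simp [card_filter_lt]
  have h2 : |∑ t : Fin (2 * T) with T ≤ t.val, a t| ≤ T := by
    refine (Finset.abs_sum_le_sum_abs _ _).trans ((Finset.sum_le_sum fun t _ => ha t).trans ?_)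
    simp [card_filter_ge]
  rw [abs_mul, abs_mul, abs_of_pos (by positivity : 0 < 1 / (T : ℝ) ^ 2), mul_assoc,
    one_div_mul_eq_div, div_le_one (by positivity), sq]
  exact mul_le_mul h1 h2 (abs_nonneg _) hT'.le

theorem abs_entry_sub_le (b c : Bool) : |entry b - entry c| ≤ 1 := by
  cases b <;> cases c <;> simp [entry]

theorem sliceStat_mem {n T : ℕ} (hT : 0 < T) (g : Obs n T) (i j k : Fin n) :
    sliceStat g i j k ∈ Set.Icc (-2 : ℝ) 2 := by
  rw [Set.mem_Icc, ← abs_le]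
  refine (abs_add_le _ _).trans ?_
  have h1 := abs_half_mul_half_le hT (a := fun t => entry (g t i k) - entry (g t j k))
    fun t => abs_entry_sub_le _ _
  have h2 := abs_half_mul_half_le hT (a := fun t => entry (g t k i) - entry (g t k j))
    fun t => abs_entry_sub_le _ _
  linarith

theorem measurable_entry_apply {n T : ℕ} (c : Fin (2 * T) × Fin n × Fin n) :
    Measurable fun ω : Fin (2 * T) × Fin n × Fin n → Bool => entry (ω c) :=
  measurable_entry.comp (measurable_pi_apply c)

theorem integrable_edgeLaw {n T : ℕ} (p : Fin n → Fin n → I)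
    (f : (Fin (2 * T) × Fin n × Fin n → Bool) → ℝ) : Integrable f (edgeLaw T p) :=
  .of_finite

/-- The two factors use disjoint sets of times, hence are independent with the same mean up to
scale. Splitting the sample thus makes the estimate of the square unbiased, without a variance term.
-/
theorem integral_half_mul_half {n T : ℕ} (hT : 0 < T) (p : Fin n → Fin n → I)
    (c d : Fin n × Fin n) :
    ∫ ω, 1 / (T : ℝ) ^ 2 * (∑ t : Fin (2 * T) with t.val < T, (entry (ω (t, c)) - entry (ω (t, d))))
      * (∑ t : Fin (2 * T) with T ≤ t.val, (entry (ω (t, c)) - entry (ω (t, d)))) ∂(edgeLaw T p) =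
      ((p c.1 c.2 : ℝ) - p d.1 d.2) ^ 2 := by
  have hT' : (0 : ℝ) < T := by exact_mod_cast hT
  have hpair : ∀ t t' : Fin (2 * T), t ≠ t' →
      ∫ ω, (entry (ω (t, c)) - entry (ω (t, d))) * (entry (ω (t', c)) - entry (ω (t', d)))
        ∂(edgeLaw T p) = ((p c.1 c.2 : ℝ) - p d.1 d.2) ^ 2 := by
    intro t t' htt
    have hi := (iIndepFun_entry (T := T) p).indepFun_sub_sub measurable_entry_apply
      (t, c) (t, d) (t', c) (t', d) (by simp [htt]) (by simp [htt]) (by simp [htt]) (by simp [htt])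
    have := hi.integral_fun_mul_eq_mul_integral (integrable_edgeLaw p _).aestronglyMeasurable
      (integrable_edgeLaw p _).aestronglyMeasurable
    simp only [Pi.sub_apply] at this
    rw [this, integral_sub (integrable_edgeLaw p _) (integrable_edgeLaw p _),
      integral_sub (integrable_edgeLaw p _) (integrable_edgeLaw p _)]
    simp only [integral_entry]
    ring
  simp_rw [mul_assoc, Finset.sum_mul_sum]
  rw [integral_const_mul, integral_finsetSum _ fun _ _ => integrable_edgeLaw p _]
  simp_rw [integral_finsetSum _ fun _ _ => integrable_edgeLaw p _]
  rw [Finset.sum_congr rfl fun t ht => Finset.sum_congr rfl fun t' ht' => hpair t t' ?_]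
  · simp only [Finset.sum_const, card_filter_lt, card_filter_ge, nsmul_eq_mul]
    field_simp
  · rintro rfl
    simp only [Finset.mem_filter] at ht ht'
    omega

theorem integral_sliceStat {n T : ℕ} (hT : 0 < T) (p : Fin n → Fin n → I)
    (i j k : Fin n) :
    ∫ ω, sliceStat (toObs ω) i j k ∂(edgeLaw T p) =
      ((p i k : ℝ) - p j k) ^ 2 + ((p k i : ℝ) - p k j) ^ 2 := by
  unfold sliceStat
  rw [integral_add (integrable_edgeLaw p _) (integrable_edgeLaw p _)]
  exact congrArg₂ (· + ·)
    (integral_half_mul_half hT p (i, k) (j, k))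
    (integral_half_mul_half hT p (k, i) (k, j))

/-- Distinct k use disjoint sets of edges. This needs k ∉ {i, j}: otherwise the edges between i and
j would be shared by k = i and k = j. -/
theorem iIndepFun_sliceStat {n T : ℕ} (p : Fin n → Fin n → I) {i j : Fin n} (hij : i ≠ j) :
    iIndepFun (fun (k : {k : Fin n // k ≠ i ∧ k ≠ j}) ω => sliceStat (toObs ω) i j (k : Fin n))
      (edgeLaw T p) := by
  -- The first Boolean chooses between edges into k and edges out of k, the second between i and j
  -- as the other end.
  let φ : {k : Fin n // k ≠ i ∧ k ≠ j} × (Fin (2 * T) × Bool × Bool) →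
      Fin (2 * T) × Fin n × Fin n := fun q =>
    bif q.2.2.1 then (q.2.1, bif q.2.2.2 then i else j, q.1)
      else (q.2.1, q.1, bif q.2.2.2 then i else j)
  have hφ : φ.Injective := by
    rintro ⟨⟨k, hk⟩, t, s, b⟩ ⟨⟨k', hk'⟩, t', s', b'⟩ h
    cases s <;> cases b <;> cases s' <;> cases b' <;> simp [φ] at h ⊢ <;> grind
  have h := iIndepFun_curry (fun k c => measurable_entry_apply (φ (k, c)))
    ((iIndepFun_entry (T := T) p).precomp hφ)
  let F : (Fin (2 * T) × Bool × Bool → ℝ) → ℝ := fun y =>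
    1 / (T : ℝ) ^ 2 *
      (∑ t : Fin (2 * T) with t.val < T, (y (t, true, true) - y (t, true, false)))
      * (∑ t : Fin (2 * T) with T ≤ t.val, (y (t, true, true) - y (t, true, false)))
    + 1 / (T : ℝ) ^ 2 *
      (∑ t : Fin (2 * T) with t.val < T, (y (t, false, true) - y (t, false, false)))
      * (∑ t : Fin (2 * T) with T ≤ t.val, (y (t, false, true) - y (t, false, false)))
  have hF : Measurable F := by fun_prop
  exact h.comp (fun _ => F) fun _ => hF

/-- Concentration of the estimated distance around the distance of the slices. -/
theorem edgeLaw_abs_dHat_sub_ge_le {n T : ℕ} (hT : 0 < T) (p : Fin n → Fin n → I)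
    (N : Fin n → Fin n → Finset (Fin n)) {i j : Fin n} (hij : i ≠ j) (hi : i ∉ N i j)
    (hj : j ∉ N i j) (hN : 0 < (N i j).card) {δ : ℝ} (hδ : 0 ≤ δ) :
    edgeLaw T p {ω | δ ≤ |dHat (toObs ω) N i j - sliceDist p N i j|} ≤
      ENNReal.ofReal (2 * Real.exp (-((N i j).card * δ ^ 2 / 2))) := by
  classical
  have hS : (0 : ℝ) < (N i j).card := by exact_mod_cast hN
  have hmem : ∀ k ∈ N i j, k ≠ i ∧ k ≠ j := fun k hk =>
    ⟨fun h => hi (h ▸ hk), fun h => hj (h ▸ hk)⟩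
  -- The factor 1/(2|N|) in `dHat` turns δ into a deviation 2|N|δ of the sum; the range has length
  -- 4.
  have h := measure_abs_sum_sub_integral_ge_le (iIndepFun_sliceStat (T := T) p hij)
    (fun k => measurable_of_finite _) (a := -2) (b := 2)
    (fun k ω => sliceStat_mem hT _ _ _ _)
    ((N i j).subtype fun k => k ≠ i ∧ k ≠ j) (m := (N i j).card) hS
    (by rw [Finset.card_subtype, Finset.filter_true_of_mem hmem]) (by norm_num)
    (ε := 2 * (N i j).card * δ) (by positivity)
  simp only [integral_sliceStat hT p] at h
  refine (measure_mono fun ω hω => ?_).trans (h.trans_eq ?_)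
  · simp only [Set.mem_ofPred_eq] at hω ⊢
    rw [Finset.sum_subtype_of_mem (p := fun k => k ≠ i ∧ k ≠ j) (s := N i j)
      (fun k => sliceStat (toObs ω) i j k - (((p i k : ℝ) - p j k) ^ 2 + ((p k i : ℝ) - p k j) ^ 2))
      hmem, Finset.sum_sub_distrib]
    rw [dHat_eq_sum_sliceStat, sliceDist, ← mul_sub, ← mul_sub, abs_mul, abs_mul,
      abs_of_pos (by norm_num : (0 : ℝ) < 1 / 2),
      abs_of_pos (by positivity : 0 < 1 / ((N i j).card : ℝ))] at hω
    field_simp at hω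
    linarith
  · congr 3
    field_simp
    ring

/-! ### Combinatorics of the greedy clustering -/

section Greedy

variable {V : Type*} [DecidableEq V] {d : V → V → ℝ} {Δ : ℝ} {R : Finset V} {B : List (Finset V)}

theorem mem_pivotBlock {p v : V} : v ∈ pivotBlock d Δ R p ↔ v ∈ R ∧ (v = p ∨ d p v ≤ Δ ^ 2) := by
  simp [pivotBlock]

theorem blockOf_cons_of_mem {b : Finset V} {i : V} (h : i ∈ b) : blockOf (b :: B) i = b := by
  simp [blockOf, h]

theorem blockOf_cons_of_notMem {b : Finset V} {i : V} (h : i ∉ b) :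
    blockOf (b :: B) i = blockOf B i := by
  simp [blockOf, h]

theorem IsGreedyRun.mem_blockOf (h : IsGreedyRun d Δ R B) : ∀ i ∈ R, i ∈ blockOf B i := by
  induction h with
  | done => simp
  | step R p hp B hB ih =>
    intro i hi
    by_cases hb : i ∈ pivotBlock d Δ R p
    · rwa [blockOf_cons_of_mem hb]
    · rw [blockOf_cons_of_notMem hb]
      exact ih i (Finset.mem_sdiff.2 ⟨hi, hb⟩)

theorem IsGreedyRun.exists_pivot (h : IsGreedyRun d Δ R B) :
    ∀ i ∈ R, ∃ p, ∀ v ∈ blockOf B i, v = p ∨ d p v ≤ Δ ^ 2 := by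
  induction h with
  | done => simp
  | step R p hp B hB ih =>
    intro i hi
    by_cases hb : i ∈ pivotBlock d Δ R p
    · rw [blockOf_cons_of_mem hb]
      exact ⟨p, fun v hv => (mem_pivotBlock.1 hv).2⟩
    · rw [blockOf_cons_of_notMem hb]
      exact ih i (Finset.mem_sdiff.2 ⟨hi, hb⟩)

/-- Each block contributes |b| · (1/|b|) = 1. This is how the noise, which is divided by block
sizes, is controlled by the number of blocks alone. -/
theorem IsGreedyRun.sum_inv_card_blockOf_le (h : IsGreedyRun d Δ R B) :
    ∑ i ∈ R, 1 / ((blockOf B i).card : ℝ) ≤ B.length := by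
  induction h with
  | done => simp
  | step R p hp B hB ih =>
    have hsub : pivotBlock d Δ R p ⊆ R := fun v hv => (mem_pivotBlock.1 hv).1
    have hpos : 0 < (pivotBlock d Δ R p).card :=
      Finset.card_pos.2 ⟨p, mem_pivotBlock.2 ⟨hp, .inl rfl⟩⟩
    rw [← Finset.sum_sdiff hsub, List.length_cons, Nat.cast_add, Nat.cast_one]
    refine add_le_add ((Finset.sum_congr rfl fun i hi => ?_).trans_le ih) (le_of_eq ?_)
    · rw [blockOf_cons_of_notMem (Finset.mem_sdiff.1 hi).2]
    · rw [Finset.sum_congr rfl fun i hi => by rw [blockOf_cons_of_mem hi], Finset.sum_const,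
        nsmul_eq_mul, mul_one_div_cancel (by exact_mod_cast hpos.ne')]

/-- There are at most as many blocks as classes of vertices with small mutual distance. -/
theorem IsGreedyRun.length_le_card_image {C : Type*} [DecidableEq C] (f : V → C)
    (hf : ∀ p q, p ≠ q → f p = f q → d p q ≤ Δ ^ 2) (h : IsGreedyRun d Δ R B) :
    B.length ≤ (R.image f).card := by
  induction h with
  | done => simp
  | step R p hp B hB ih =>
    -- The pivot's block swallows every remaining vertex of its class, so each step uses up a class.
    have hsub : (R \ pivotBlock d Δ R p).image f ⊆ (R.image f).erase (f p) := by
      intro c hc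
      obtain ⟨q, hq, rfl⟩ := Finset.mem_image.1 hc
      rw [Finset.mem_sdiff, mem_pivotBlock] at hq
      refine Finset.mem_erase.2 ⟨fun hpq => hq.2 ⟨hq.1, ?_⟩, Finset.mem_image_of_mem f hq.1⟩
      by_cases hqp : q = p
      · exact .inl hqp
      · exact .inr (hf p q (Ne.symm hqp) hpq.symm)
    have h1 := ih.trans (Finset.card_le_card hsub)
    have h2 := Finset.card_erase_add_one (Finset.mem_image_of_mem f hp)
    rw [List.length_cons]
    omega

end Greedy

/-! ### Partition of the unit interval into small cells -/

section Cells

variable {K : ℕ} {α : Fin (K + 1) → I}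

/-- `Q` has diameter at most `h` and lies in one of the intervals between the break points. -/
def IsCell (α : Fin (K + 1) → I) (h : ℝ) (Q : Set I) : Prop :=
  ∃ i : Fin K, Q ⊆ Set.Ioo (α i.castSucc) (α i.succ) ∧
    ∀ x ∈ Q, ∀ y ∈ Q, |(x : ℝ) - (y : ℝ)| ≤ h

theorem exists_mem_Ioo_of_notMem_range (h0 : α 0 = 0) (h1 : α (Fin.last K) = 1) {x : I}
    (hx : x ∉ Set.range α) : ∃ i : Fin K, x ∈ Set.Ioo (α i.castSucc) (α i.succ) := by
  by_contra! hcon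
  have hne : ∀ i, α i ≠ x := fun i hi => hx ⟨i, hi⟩
  have : ∀ i, α i < x := by
    intro i
    induction i using Fin.induction with
    | zero => exact lt_of_le_of_ne (h0 ▸ unitInterval.nonneg') (hne 0)
    | succ i ih =>
      have := hcon i
      rw [Set.mem_Ioo, not_and, not_lt] at this
      exact lt_of_le_of_ne (this ih) (hne _)
  exact absurd (this (Fin.last K)) (not_lt.2 (h1 ▸ unitInterval.le_one'))

/-- Up to a null set, `[0,1]` is covered by finitely many cells of positive measure. -/
theorem exists_cells (h0 : α 0 = 0) (h1 : α (Fin.last K) = 1) {h : ℝ} (hh : 0 < h) :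
    ∃ (C : Finset (Set I)) (m₀ : ℝ), 0 < m₀ ∧ (C.card : ℝ) ≤ K * (1 / h + 1) ∧
      (∀ Q ∈ C, MeasurableSet Q ∧ m₀ ≤ volume.real Q ∧ IsCell α h Q) ∧
      ∀ᵐ x : I, ∃ Q ∈ C, x ∈ Q := by
  classical
  let cell : Fin K × ℕ → Set I := fun q =>
    Set.Ioo (α q.1.castSucc) (α q.1.succ) ∩ {x | ⌊(x : ℝ) / h⌋₊ = q.2}
  have hcm : ∀ q, MeasurableSet (cell q) := fun q => by
    refine measurableSet_Ioo.inter ?_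
    have : Measurable fun x : I => ⌊(x : ℝ) / h⌋₊ := by fun_prop
    exact this (measurableSet_singleton q.2)
  have hcc : ∀ q, IsCell α h (cell q) := by
    refine fun q => ⟨q.1, Set.inter_subset_left, fun x hx y hy => ?_⟩
    have hx1 := Nat.floor_le (div_nonneg x.2.1 hh.le)
    have hx2 := Nat.lt_floor_add_one ((x : ℝ) / h)
    have hy1 := Nat.floor_le (div_nonneg y.2.1 hh.le)
    have hy2 := Nat.lt_floor_add_one ((y : ℝ) / h)
    have ex : ⌊(x : ℝ) / h⌋₊ = q.2 := hx.2
    have ey : ⌊(y : ℝ) / h⌋₊ = q.2 := hy.2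
    rw [ex] at hx1 hx2
    rw [ey] at hy1 hy2
    rw [le_div_iff₀ hh] at hx1 hy1
    rw [div_lt_iff₀ hh] at hx2 hy2
    rw [abs_le]
    constructor <;> nlinarith
  -- The index ⌊1/h⌋ itself occurs for points near 1, hence the `+ 1`.
  let idx : Finset (Fin K × ℕ) := Finset.univ ×ˢ Finset.range (⌊1 / h⌋₊ + 1)
  -- Dropping the null cells loses only a null set and allows a common positive lower bound `m₀` for
  -- the masses.
  let C : Finset (Set I) := (idx.image cell).filter fun Q => volume Q ≠ 0
  have hC : ∀ Q ∈ C, ∃ q, cell q = Q ∧ 0 < volume.real Q := by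
    intro Q hQ
    obtain ⟨hQ1, hQ2⟩ := Finset.mem_filter.1 hQ
    obtain ⟨q, -, rfl⟩ := Finset.mem_image.1 hQ1
    exact ⟨q, rfl, ENNReal.toReal_pos hQ2 (measure_ne_top _ _)⟩
  have hm : ∀ᶠ m : ℝ in 𝓝[>] 0, ∀ Q ∈ C, m ≤ volume.real Q := by
    refine (Filter.eventually_all_finset C).2 fun Q hQ => ?_
    obtain ⟨q, -, hpos⟩ := hC Q hQ
    exact nhdsWithin_le_nhds (eventually_le_nhds hpos)
  obtain ⟨m₀, hm₀, hpos⟩ := (hm.and self_mem_nhdsWithin).exists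
  refine ⟨C, m₀, hpos, ?_, fun Q hQ => ?_, ?_⟩
  · have hc : C.card ≤ K * (⌊1 / h⌋₊ + 1) :=
      (Finset.card_filter_le _ _).trans (Finset.card_image_le.trans (by simp [idx]))
    have hf := Nat.floor_le (one_div_pos.2 hh).le
    calc (C.card : ℝ) ≤ K * (⌊1 / h⌋₊ + 1) := by exact_mod_cast hc
      _ ≤ K * (1 / h + 1) := by gcongr
  · obtain ⟨q, rfl, -⟩ := hC Q hQ
    exact ⟨hcm q, hm₀ _ hQ, hcc q⟩
  · have hn1 : ∀ᵐ x : I, x ∉ Set.range α :=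
      measure_eq_zero_iff_ae_notMem.1 ((Set.finite_range α).measure_zero _)
    have hn2 : ∀ᵐ x : I, ∀ q : {q : Fin K × ℕ // volume (cell q) = 0}, x ∉ cell q :=
      ae_all_iff.2 fun q => measure_eq_zero_iff_ae_notMem.1 q.2
    filter_upwards [hn1, hn2] with x hx1 hx2
    obtain ⟨i, hi⟩ := exists_mem_Ioo_of_notMem_range h0 h1 hx1
    have hx : x ∈ cell (i, ⌊(x : ℝ) / h⌋₊) := ⟨hi, rfl⟩
    refine ⟨_, Finset.mem_filter.2 ⟨Finset.mem_image.2 ⟨(i, ⌊(x : ℝ) / h⌋₊), ?_, rfl⟩, ?_⟩, hx⟩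
    · simp only [idx, Finset.mem_product, Finset.mem_univ, Finset.mem_range, true_and]
      exact Nat.lt_succ_of_le (Nat.floor_le_floor (by gcongr; exact x.2.2))
    · exact fun h0 => hx2 ⟨_, h0⟩ hx

end Cells

/-- `w` is `L`-Lipschitz on the rectangles with sides between consecutive break points `α`. -/
def LipschitzOnPieces {K : ℕ} (α : Fin (K + 1) → I) (L : ℝ) (w : I → I → I) : Prop :=
  ∀ i j : Fin K,
    ∀ x₁ ∈ Set.Ioo (α i.castSucc) (α i.succ), ∀ x₂ ∈ Set.Ioo (α i.castSucc) (α i.succ),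
    ∀ y₁ ∈ Set.Ioo (α j.castSucc) (α j.succ), ∀ y₂ ∈ Set.Ioo (α j.castSucc) (α j.succ),
      |(w x₁ y₁ : ℝ) - (w x₂ y₂ : ℝ)| ≤ L * (|(x₁ : ℝ) - (x₂ : ℝ)| + |(y₁ : ℝ) - (y₂ : ℝ)|)

/-! ### Deterministic error analysis on the good event -/

section Deterministic

variable {K : ℕ} {α : Fin (K + 1) → I} {L : ℝ} {w : I → I → I}

theorem LipschitzOnPieces.abs_sub_left_le (hw : LipschitzOnPieces α L w) (hL : 0 ≤ L) {h : ℝ}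
    {Q : Set I} (hQ : IsCell α h Q) {x y z : I} (hx : x ∈ Q) (hy : y ∈ Q) {i : Fin K}
    (hz : z ∈ Set.Ioo (α i.castSucc) (α i.succ)) :
    |(w x z : ℝ) - w y z| ≤ L * h := by
  obtain ⟨j, hj, hd⟩ := hQ
  refine (hw j i x (hj hx) y (hj hy) z hz z hz).trans ?_
  rw [sub_self, abs_zero, add_zero]
  exact mul_le_mul_of_nonneg_left (hd x hx y hy) hL

theorem LipschitzOnPieces.abs_sub_right_le (hw : LipschitzOnPieces α L w) (hL : 0 ≤ L) {h : ℝ}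
    {Q : Set I} (hQ : IsCell α h Q) {x y z : I} (hx : x ∈ Q) (hy : y ∈ Q) {i : Fin K}
    (hz : z ∈ Set.Ioo (α i.castSucc) (α i.succ)) :
    |(w z x : ℝ) - w z y| ≤ L * h := by
  obtain ⟨j, hj, hd⟩ := hQ
  refine (hw i j z hz z hz x (hj hx) y (hj hy)).trans ?_
  rw [sub_self, abs_zero, zero_add]
  exact mul_le_mul_of_nonneg_left (hd x hx y hy) hL

/-- Vertices whose labels lie in a common cell have close slices. -/
theorem LipschitzOnPieces.sliceDist_le (hw : LipschitzOnPieces α L w) (hL : 0 ≤ L) {n : ℕ}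
    {x : Fin n → I} (hx : ∀ k, ∃ i : Fin K, x k ∈ Set.Ioo (α i.castSucc) (α i.succ))
    (N : Fin n → Fin n → Finset (Fin n)) {h : ℝ} {Q : Set I} (hQ : IsCell α h Q)
    {i j : Fin n} (hi : x i ∈ Q) (hj : x j ∈ Q) :
    sliceDist (fun i j => w (x i) (x j)) N i j ≤ L ^ 2 * h ^ 2 := by
  have hterm : ∀ k ∈ N i j, ((w (x i) (x k) : ℝ) - w (x j) (x k)) ^ 2
      + ((w (x k) (x i) : ℝ) - w (x k) (x j)) ^ 2 ≤ 2 * (L ^ 2 * h ^ 2) := by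
    intro k _
    obtain ⟨l, hl⟩ := hx k
    have h1 := pow_le_pow_left₀ (abs_nonneg _) (hw.abs_sub_left_le hL hQ hi hj hl) 2
    have h2 := pow_le_pow_left₀ (abs_nonneg _) (hw.abs_sub_right_le hL hQ hi hj hl) 2
    rw [sq_abs, mul_pow] at h1 h2
    linarith
  have hsum := Finset.sum_le_card_nsmul _ _ _ hterm
  rw [nsmul_eq_mul] at hsum
  unfold sliceDist
  -- For an empty neighborhood, division by zero makes `sliceDist` equal to 0.
  rcases (Nat.cast_nonneg (N i j).card : (0 : ℝ) ≤ _).eq_or_lt with h0 | h0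
  · rw [← h0]
    simp only [div_zero, zero_mul, mul_zero]
    positivity
  · have : 1 / ((N i j).card : ℝ) * ∑ k ∈ N i j, (((w (x i) (x k) : ℝ) - w (x j) (x k)) ^ 2
      + ((w (x k) (x i) : ℝ) - w (x k) (x j)) ^ 2) ≤ 2 * (L ^ 2 * h ^ 2) := by
      rwa [one_div_mul_eq_div, div_le_iff₀' h0]
    linarith

/-- If many labels of the neighborhood lie in a set where a slice difference exceeds `ε`, then the
distance of the slices is large. -/
theorem lt_sliceDist {n : ℕ} (p : Fin n → Fin n → I) (N : Fin n → Fin n → Finset (Fin n))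
    {i j : Fin n} {x : Fin n → I} {Q : Set I} {m₀ ε : ℝ} (hε : 0 < ε) (hN : 0 < (N i j).card)
    (hcount : (N i j).card * m₀ / 2 < ∑ k ∈ N i j, Q.indicator 1 (x k))
    (hQ : ∀ k, x k ∈ Q → ε ≤ |(p i k : ℝ) - p j k| ∨ ε ≤ |(p k i : ℝ) - p k j|) :
    m₀ * ε ^ 2 / 4 < sliceDist p N i j := by
  have hS : (0 : ℝ) < (N i j).card := by exact_mod_cast hN
  have hsum : ε ^ 2 * ∑ k ∈ N i j, Q.indicator (1 : I → ℝ) (x k) ≤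
      ∑ k ∈ N i j, (((p i k : ℝ) - p j k) ^ 2 + ((p k i : ℝ) - p k j) ^ 2) := by
    rw [Finset.mul_sum]
    refine Finset.sum_le_sum fun k _ => ?_
    by_cases hk : x k ∈ Q
    · rw [Set.indicator_of_mem hk, Pi.one_apply, mul_one]
      rcases hQ k hk with h | h
      · have := pow_le_pow_left₀ hε.le h 2
        rw [sq_abs] at this
        nlinarith [sq_nonneg ((p k i : ℝ) - p k j)]
      · have := pow_le_pow_left₀ hε.le h 2
        rw [sq_abs] at this
        nlinarith [sq_nonneg ((p i k : ℝ) - p j k)]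
    · rw [Set.indicator_of_notMem hk, mul_zero]
      positivity
  have h1 := mul_lt_mul_of_pos_left hcount (pow_pos hε 2)
  have h2 : m₀ * ε ^ 2 / 2 < 1 / ((N i j).card : ℝ) *
      ∑ k ∈ N i j, (((p i k : ℝ) - p j k) ^ 2 + ((p k i : ℝ) - p k j) ^ 2) := by
    rw [one_div_mul_eq_div, lt_div_iff₀' hS]
    nlinarith
  unfold sliceDist
  linarith

/-- Small distance of slices implies that the slices are uniformly close. -/
theorem LipschitzOnPieces.abs_sub_le_of_sliceDist_le (hw : LipschitzOnPieces α L w) (hL : 0 ≤ L)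
    {n : ℕ} {x : Fin n → I} (hx : ∀ k, ∃ i : Fin K, x k ∈ Set.Ioo (α i.castSucc) (α i.succ))
    (N : Fin n → Fin n → Finset (Fin n)) {h m₀ η : ℝ} (hη : 0 < η) (hLh : L * h ≤ η / 4)
    {Q : Set I} (hQ : IsCell α h Q) {i j : Fin n} (hN : 0 < (N i j).card)
    (hcount : (N i j).card * m₀ / 2 < ∑ k ∈ N i j, Q.indicator 1 (x k))
    (hdist : sliceDist (fun i j => w (x i) (x j)) N i j ≤ m₀ * η ^ 2 / 16) {y : I} (hy : y ∈ Q) :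
    |(w (x i) y : ℝ) - w (x j) y| ≤ η ∧ |(w y (x i) : ℝ) - w y (x j)| ≤ η := by
  obtain ⟨ki, hki⟩ := hx i
  obtain ⟨kj, hkj⟩ := hx j
  by_contra hcon
  rw [not_and_or, not_le, not_le] at hcon
  refine absurd hdist (not_le.2 ?_)
  -- Moving from y to another point of Q changes each of the two slices by at most L h ≤ η/4, so a
  -- gap above η at y stays above η/2 on all of Q.
  have := lt_sliceDist (fun i j => w (x i) (x j)) N (x := x) (Q := Q) (m₀ := m₀) (half_pos hη) hN
    hcount (i := i) (j := j) ?_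
  · refine lt_of_eq_of_lt ?_ this
    ring
  · intro k hk
    rcases hcon with hc | hc
    · left
      have h1 := hw.abs_sub_right_le hL hQ hk hy hki
      have h2 := hw.abs_sub_right_le hL hQ hk hy hkj
      rw [abs_le] at h1 h2
      rw [lt_abs] at hc
      rw [le_abs]
      rcases hc with hc | hc
      · left; linarith
      · right; linarith
    · right
      have h1 := hw.abs_sub_left_le hL hQ hk hy hki
      have h2 := hw.abs_sub_left_le hL hQ hk hy hkj
      rw [abs_le] at h1 h2
      rw [lt_abs] at hc
      rw [le_abs]
      rcases hc with hc | hc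
      · left; linarith
      · right; linarith

/-- Error of the estimate for one pair: oscillation on the blocks plus noise. -/
theorem abs_sub_wHat_le {n T : ℕ} (hT : 0 < T) (p : Fin n → Fin n → I) (G : Obs n T)
    (B : List (Finset (Fin n))) {i j : Fin n} (hi : (blockOf B i).Nonempty)
    (hj : (blockOf B j).Nonempty) {η τ : ℝ}
    (hosc : ∀ a ∈ blockOf B i, ∀ b ∈ blockOf B j, |(p i j : ℝ) - p a b| ≤ η)
    (hnoise : |∑ a ∈ blockOf B i, ∑ b ∈ blockOf B j, ∑ t, (entry (G t a b) - (p a b : ℝ))| ≤ τ) :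
    |(p i j : ℝ) - wHat G B i j| ≤
      η + τ / (2 * T) * (1 / ((blockOf B i).card : ℝ) * (1 / ((blockOf B j).card : ℝ))) := by
  have hT' : (0 : ℝ) < T := by exact_mod_cast hT
  have hci : (0 : ℝ) < (blockOf B i).card := by exact_mod_cast hi.card_pos
  have hcj : (0 : ℝ) < (blockOf B j).card := by exact_mod_cast hj.card_pos
  set bi := blockOf B i
  set bj := blockOf B j
  set c : ℝ := (bi.card : ℝ) * bj.card
  have hc : 0 < c := mul_pos hci hcj
  have hbias : |∑ a ∈ bi, ∑ b ∈ bj, ((p i j : ℝ) - p a b)| ≤ c * η := by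
    refine (Finset.abs_sum_le_sum_abs _ _).trans ?_
    have : ∀ a ∈ bi, |∑ b ∈ bj, ((p i j : ℝ) - p a b)| ≤ bj.card * η := fun a ha => by
      refine (Finset.abs_sum_le_sum_abs _ _).trans
        ((Finset.sum_le_card_nsmul _ _ _ fun b hb => hosc a ha b hb).trans_eq ?_)
      rw [nsmul_eq_mul]
    refine (Finset.sum_le_card_nsmul _ _ _ this).trans_eq ?_
    rw [nsmul_eq_mul, mul_assoc]
  have hdecomp : (p i j : ℝ) - wHat G B i j = 1 / c * ∑ a ∈ bi, ∑ b ∈ bj, ((p i j : ℝ) - p a b)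
      - 1 / c * (1 / (2 * T) * ∑ a ∈ bi, ∑ b ∈ bj, ∑ t, (entry (G t a b) - (p a b : ℝ))) := by
    have h1 : wHat G B i j = 1 / c * ∑ a ∈ bi, ∑ b ∈ bj, 1 / (2 * (T : ℝ)) * ∑ t, entry (G t a b) :=
      rfl
    have h2 : (1 / (2 * T : ℝ) * ∑ a ∈ bi, ∑ b ∈ bj, ∑ t, (entry (G t a b) - (p a b : ℝ))) =
        ∑ a ∈ bi, ∑ b ∈ bj, (1 / (2 * (T : ℝ)) * ∑ t, entry (G t a b)) -
          ∑ a ∈ bi, ∑ b ∈ bj, (p a b : ℝ) := by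
      simp only [Finset.mul_sum, ← Finset.sum_sub_distrib]
      refine Finset.sum_congr rfl fun a _ => Finset.sum_congr rfl fun b _ => ?_
      rw [← Finset.mul_sum, ← Finset.mul_sum, Finset.sum_sub_distrib, Finset.sum_const,
        Finset.card_univ, Fintype.card_fin, nsmul_eq_mul, mul_sub]
      push_cast
      field_simp
    rw [h1, h2]
    simp only [Finset.sum_sub_distrib, Finset.sum_const, nsmul_eq_mul]
    have : 1 / c * (bi.card * (bj.card * (p i j : ℝ))) = p i j := by
      simp only [c]; field_simp
    rw [mul_sub (1 / c), this]
    ring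
  rw [hdecomp]
  refine (abs_sub _ _).trans ?_
  rw [abs_mul, abs_mul, abs_mul, abs_of_pos (one_div_pos.2 hc),
    abs_of_pos (by positivity : (0 : ℝ) < 1 / (2 * T))]
  have e1 : 1 / c * |∑ a ∈ bi, ∑ b ∈ bj, ((p i j : ℝ) - p a b)| ≤ η := by
    rwa [one_div_mul_eq_div, div_le_iff₀' hc]
  have e2 : 1 / c * (1 / (2 * T) * |∑ a ∈ bi, ∑ b ∈ bj, ∑ t, (entry (G t a b) - (p a b : ℝ))|) ≤
      1 / c * (1 / (2 * T) * τ) := by gcongr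
  refine (add_le_add e1 e2).trans_eq ?_
  simp only [c]
  field_simp

/-- The error on the event where distances, label counts and edge counts are concentrated. -/
theorem LipschitzOnPieces.mae_le (hw : LipschitzOnPieces α L w) (hL : 0 ≤ L) {n T : ℕ} (hT : 0 < T)
    {x : Fin n → I} {g : Obs n T} {N : Fin n → Fin n → Finset (Fin n)}
    {B : List (Finset (Fin n))} {Δ h h' m₀ η τ : ℝ}
    (hrun : IsGreedyRun (dHat g N) Δ Finset.univ B) (hη : 0 < η) (hLh : L * h ≤ η / 4)
    (hLh' : L ^ 2 * h' ^ 2 ≤ Δ ^ 2 / 2) (hΔ : 3 / 2 * Δ ^ 2 ≤ m₀ * η ^ 2 / 16) (hτ : 0 ≤ τ)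
    {C C' : Finset (Set I)} (hC : ∀ Q ∈ C, IsCell α h Q) (hC' : ∀ Q ∈ C', IsCell α h' Q)
    (hxC : ∀ k, ∃ Q ∈ C, x k ∈ Q) (hxC' : ∀ k, ∃ Q ∈ C', x k ∈ Q)
    (hN : ∀ i j, i ≠ j → 0 < (N i j).card)
    (hdist : ∀ i j, i ≠ j →
      |dHat g N i j - sliceDist (fun i j => w (x i) (x j)) N i j| ≤ Δ ^ 2 / 2)
    (hcount : ∀ i j, i ≠ j → ∀ Q ∈ C,
      (N i j).card * m₀ / 2 < ∑ k ∈ N i j, Q.indicator 1 (x k))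
    (hnoise : ∀ A A' : Finset (Fin n),
      |∑ i ∈ A, ∑ j ∈ A', ∑ t, (entry (g t i j) - (w (x i) (x j) : ℝ))| ≤ τ) :
    mae w x g B ≤ 4 * η + τ / (2 * T) * (C'.card : ℝ) ^ 2 / (n : ℝ) ^ 2 := by
  classical
  have hx : ∀ k, ∃ i : Fin K, x k ∈ Set.Ioo (α i.castSucc) (α i.succ) := by
    intro k
    obtain ⟨Q, hQ, hk⟩ := hxC k
    obtain ⟨i, hi, -⟩ := hC Q hQ
    exact ⟨i, hi hk⟩
  choose f hfC' hf using hxC'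
  -- In a common cell of `C'`, `sliceDist` ≤ Δ²/2; the deviation adds at most Δ²/2, which exactly
  -- meets the threshold Δ².
  have hlen : B.length ≤ C'.card := by
    refine (hrun.length_le_card_image f fun p q hpq hfpq => ?_).trans
      (Finset.card_le_card (Finset.image_subset_iff.2 fun k _ => hfC' k))
    have h1 := hw.sliceDist_le hL hx N (hC' _ (hfC' p)) (hf p) (hfpq ▸ hf q)
    have h2 := (abs_le.1 (hdist p q hpq)).2
    linarith
  -- Both i and a are compared with the pivot of their block, each at cost η.
  have hclose : ∀ i, ∀ a ∈ blockOf B i, ∀ k,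
      |(w (x i) (x k) : ℝ) - w (x a) (x k)| ≤ 2 * η ∧
      |(w (x k) (x i) : ℝ) - w (x k) (x a)| ≤ 2 * η := by
    intro i a ha k
    obtain ⟨p, hp⟩ := hrun.exists_pivot i (Finset.mem_univ i)
    have hpv : ∀ v ∈ blockOf B i, |(w (x p) (x k) : ℝ) - w (x v) (x k)| ≤ η ∧
        |(w (x k) (x p) : ℝ) - w (x k) (x v)| ≤ η := by
      intro v hv
      by_cases hvp : v = p
      · subst hvp; simp [hη.le]
      · obtain ⟨Q, hQ, hk⟩ := hxC k
        have hpv : p ≠ v := Ne.symm hvp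
        refine hw.abs_sub_le_of_sliceDist_le hL hx N hη hLh (hC Q hQ) (hN p v hpv)
          (hcount p v hpv Q hQ) ?_ hk
        have h1 := (hp v hv).resolve_left hvp
        have h2 := (abs_le.1 (hdist p v hpv)).1
        linarith
    have h1 := hpv i (hrun.mem_blockOf i (Finset.mem_univ i))
    have h2 := hpv a ha
    simp only [abs_le] at h1 h2 ⊢
    refine ⟨⟨?_, ?_⟩, ⟨?_, ?_⟩⟩ <;> linarith
  -- Replacing first the row and then the column label costs 2η each.
  have hpair : ∀ i j, |(w (x i) (x j) : ℝ) - wHat g B i j| ≤ 4 * η + τ / (2 * T) *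
      (1 / ((blockOf B i).card : ℝ) * (1 / ((blockOf B j).card : ℝ))) := by
    intro i j
    refine abs_sub_wHat_le hT (fun i j => w (x i) (x j)) g B
      ⟨i, hrun.mem_blockOf i (Finset.mem_univ i)⟩ ⟨j, hrun.mem_blockOf j (Finset.mem_univ j)⟩ ?_
      (hnoise _ _)
    intro a ha b hb
    have h1 := (hclose i a ha j).1
    have h2 := (hclose j b hb a).2
    simp only [abs_le] at h1 h2 ⊢
    constructor <;> linarith
  have hsum := hrun.sum_inv_card_blockOf_le
  have hsum0 : 0 ≤ ∑ i : Fin n, 1 / ((blockOf B i).card : ℝ) :=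
    Finset.sum_nonneg fun i _ => by positivity
  have hsq : (∑ i : Fin n, 1 / ((blockOf B i).card : ℝ)) ^ 2 ≤ (C'.card : ℝ) ^ 2 :=
    pow_le_pow_left₀ hsum0 (hsum.trans (by exact_mod_cast hlen)) 2
  rcases Nat.eq_zero_or_pos n with rfl | hn
  · simp only [mae, Finset.univ_eq_empty, Finset.sum_empty, mul_zero]
    positivity
  have hn' : (0 : ℝ) < n := by exact_mod_cast hn
  unfold mae
  calc 1 / (n : ℝ) ^ 2 * ∑ i : Fin n, ∑ j : Fin n, |(w (x i) (x j) : ℝ) - wHat g B i j|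
      ≤ 1 / (n : ℝ) ^ 2 * ∑ i : Fin n, ∑ j : Fin n, (4 * η + τ / (2 * T) *
      (1 / ((blockOf B i).card : ℝ) * (1 / ((blockOf B j).card : ℝ)))) := by
        gcongr with i _ j _
        exact hpair i j
    _ = 4 * η + τ / (2 * T) * (∑ i : Fin n, 1 / ((blockOf B i).card : ℝ)) ^ 2 / (n : ℝ) ^ 2 := by
        rw [sq (∑ i : Fin n, 1 / ((blockOf B i).card : ℝ)), Finset.sum_mul_sum]
        simp only [Finset.sum_add_distrib, ← Finset.mul_sum, Finset.sum_const, Finset.card_univ,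
          Fintype.card_fin, nsmul_eq_mul]
        field_simp
    _ ≤ _ := by gcongr

end Deterministic

theorem measure_exists_le_card_mul {Ω ι : Type*} [MeasurableSpace Ω] [Fintype ι] {μ : Measure Ω}
    {A : ι → Set Ω} {r : ℝ} (h : ∀ i, μ (A i) ≤ ENNReal.ofReal r) :
    μ {ω | ∃ i, ω ∈ A i} ≤ ENNReal.ofReal (Fintype.card ι * r) := by
  have e : {ω | ∃ i, ω ∈ A i} = ⋃ i, A i := by ext; simp
  rw [e]
  refine (measure_iUnion_fintype_le μ A).trans ((Finset.sum_le_sum fun i _ => h i).trans_eq ?_)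
  rw [Finset.sum_const, Finset.card_univ, nsmul_eq_mul, ENNReal.ofReal_mul (by positivity),
    ENNReal.ofReal_natCast]

/-! ### Crude bounds on the errors -/

section Bounds

variable {w : I → I → I} {n T : ℕ} (u : Fin n → I) (G : Obs n T) (B : List (Finset (Fin n)))

theorem wHat_mem (i j : Fin n) : wHat G B i j ∈ Set.Icc (0 : ℝ) 1 := by
  have h0 : ∀ x y, 0 ≤ 1 / (2 * (T : ℝ)) * ∑ t, entry (G t x y) := fun x y =>
    mul_nonneg (by positivity) (Finset.sum_nonneg fun t _ => (entry_mem _).1)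
  have h1 : ∀ x y, 1 / (2 * (T : ℝ)) * ∑ t, entry (G t x y) ≤ 1 := fun x y => by
    rw [one_div_mul_eq_div]
    refine div_le_one_of_le₀ ((Finset.sum_le_card_nsmul _ _ 1 fun t _ => (entry_mem _).2).trans ?_)
      (by positivity)
    simp
  refine ⟨mul_nonneg (by positivity)
    (Finset.sum_nonneg fun x _ => Finset.sum_nonneg fun y _ => h0 x y), ?_⟩
  rw [wHat, one_div_mul_eq_div]
  refine div_le_one_of_le₀ ((Finset.sum_le_card_nsmul _ _ ((blockOf B j).card : ℝ) fun x _ =>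
    (Finset.sum_le_card_nsmul _ _ 1 fun y _ => h1 x y).trans_eq (by simp)).trans_eq (by simp))
      (by positivity)

theorem abs_sub_wHat_le_one (i j : Fin n) : |(w (u i) (u j) : ℝ) - wHat G B i j| ≤ 1 := by
  have h1 := wHat_mem G B i j
  have h2 := (w (u i) (u j)).2
  rw [abs_le]
  constructor <;> linarith [h1.1, h1.2, h2.1, h2.2]

theorem mae_nonneg : 0 ≤ mae w u G B :=
  mul_nonneg (by positivity) (Finset.sum_nonneg fun _ _ => Finset.sum_nonneg fun _ _ => abs_nonneg _)

theorem mae_le_one : mae w u G B ≤ 1 := by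
  rw [mae, one_div_mul_eq_div]
  refine div_le_one_of_le₀ ((Finset.sum_le_card_nsmul _ _ (n : ℝ) fun i _ =>
    (Finset.sum_le_card_nsmul _ _ 1 fun j _ => abs_sub_wHat_le_one u G B i j).trans_eq
      (by simp)).trans_eq (by simp [sq])) (by positivity)

theorem mse_nonneg : 0 ≤ mse w u G B :=
  mul_nonneg (by positivity) (Finset.sum_nonneg fun _ _ => Finset.sum_nonneg fun _ _ => sq_nonneg _)

theorem mse_le_mae : mse w u G B ≤ mae w u G B := by
  unfold mse mae
  gcongr with i _ j _
  rw [← sq_abs]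
  exact pow_le_of_le_one (abs_nonneg _) (abs_sub_wHat_le_one u G B i j) two_ne_zero

end Bounds

/-! ### The probability of a large error for fixed n -/

section OneSize

variable {w : I → I → I} {n T : ℕ} {Ω : Type*} [MeasurableSpace Ω] {P : Measure Ω}
  {u : Ω → Fin n → I} {G : Ω → Obs n T} {B : Ω → List (Finset (Fin n))}

/-- Graphs and block lists take countably many values, so joint measurability reduces to
measurability in the labels. -/
theorem measurable_comp_output (h : IsGraphonSample w P u G)
    (hB : ∀ l, MeasurableSet {ω | B ω = l})
    {f : (Fin n → I) → Obs n T → List (Finset (Fin n)) → ℝ}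
    (hf : ∀ g l, Measurable fun x => f x g l) : Measurable fun ω => f (u ω) (G ω) (B ω) := by
  let _ : MeasurableSpace (List (Finset (Fin n))) := ⊤
  have hBm : Measurable B := measurable_to_countable' hB
  have hF : Measurable fun z : (Obs n T × List (Finset (Fin n))) × (Fin n → I) =>
      f z.2 z.1.1 z.1.2 :=
    measurable_from_prod_countable_right fun z => hf z.1 z.2
  exact hF.comp ((h.measurable_graph.prodMk hBm).prodMk h.measurable_label)

theorem measurable_mae (hw : Measurable (Function.uncurry w)) (h : IsGraphonSample w P u G)
    (hB : ∀ l, MeasurableSet {ω | B ω = l}) :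
    Measurable fun ω => mae w (u ω) (G ω) (B ω) := by
  refine measurable_comp_output (f := fun x g l => mae w x g l) h hB fun g l => ?_
  have := fun i j => measurable_graphon_label hw (n := n) i j
  unfold mae
  fun_prop

theorem measurable_mse (hw : Measurable (Function.uncurry w)) (h : IsGraphonSample w P u G)
    (hB : ∀ l, MeasurableSet {ω | B ω = l}) :
    Measurable fun ω => mse w (u ω) (G ω) (B ω) := by
  refine measurable_comp_output (f := fun x g l => mse w x g l) h hB fun g l => ?_
  have := fun i j => measurable_graphon_label hw (n := n) i j
  unfold mse
  fun_prop

theorem IsGraphonSample.measure_dHat_deviation_le (hw : Measurable (Function.uncurry w))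
    (h : IsGraphonSample w P u G) (hT : 0 < T) {S : ℕ} (hS : 0 < S)
    {N : Fin n → Fin n → Finset (Fin n)} (hN : ∀ i j, i ≠ j → i ∉ N i j ∧ j ∉ N i j)
    (hcard : ∀ i j, i ≠ j → (N i j).card = S) {δ : ℝ} (hδ : 0 ≤ δ) {i j : Fin n} (hij : i ≠ j) :
    P {ω | δ ≤ |dHat (G ω) N i j - sliceDist (fun i j => w (u ω i) (u ω j)) N i j|} ≤
      ENNReal.ofReal (2 * Real.exp (-(S * δ ^ 2 / 2))) := by
  refine h.measure_le hw
    {z | δ ≤ |dHat z.2 N i j - sliceDist (fun i j => w (z.1 i) (z.1 j)) N i j|} (fun g => ?_)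
    fun x => ?_
  · have := fun i j => measurable_graphon_label hw (n := n) i j
    refine measurableSet_le (measurable_const (a := δ)) (g := fun x : Fin n → I =>
      |dHat g N i j - sliceDist (fun i j => w (x i) (x j)) N i j|) ?_
    unfold sliceDist
    fun_prop
  · have := edgeLaw_abs_dHat_sub_ge_le hT (fun i j => w (x i) (x j)) N hij (hN i j hij).1
      (hN i j hij).2 (by rw [hcard i j hij]; exact hS) hδ
    rwa [hcard i j hij] at this

theorem IsGraphonSample.measure_count_le (hw : Measurable (Function.uncurry w))
    (h : IsGraphonSample w P u G) (N : Finset (Fin n)) (hN : 0 < N.card) {Q : Set I}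
    (hQ : MeasurableSet Q) {m₀ : ℝ} (hm₀ : 0 ≤ m₀) (hm : m₀ ≤ volume.real Q) :
    P {ω | ∑ k ∈ N, Q.indicator 1 (u ω k) ≤ N.card * m₀ / 2} ≤
      ENNReal.ofReal (2 * Real.exp (-(N.card * m₀ ^ 2 / 2))) := by
  refine (h.measure_label_le hw {x | ∑ k ∈ N, Q.indicator 1 (x k) ≤ N.card * m₀ / 2} ?_).trans
    (volume_card_filter_le N hN hQ hm₀ hm)
  have hf : Measurable (Q.indicator (1 : I → ℝ)) := measurable_one.indicator hQ
  exact measurableSet_le (by fun_prop) measurable_const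

theorem IsGraphonSample.measure_edge_deviation_le (hw : Measurable (Function.uncurry w))
    (h : IsGraphonSample w P u G) (hn : 0 < n) (hT : 0 < T) (A A' : Finset (Fin n)) {τ : ℝ}
    (hτ : 0 ≤ τ) :
    P {ω | τ ≤ |∑ i ∈ A, ∑ j ∈ A', ∑ t, (entry (G ω t i j) - (w (u ω i) (u ω j) : ℝ))|} ≤
      ENNReal.ofReal (2 * Real.exp (-τ ^ 2 / (T * (n : ℝ) ^ 2))) := by
  refine h.measure_le hw
    {z | τ ≤ |∑ i ∈ A, ∑ j ∈ A', ∑ t, (entry (z.2 t i j) - (w (z.1 i) (z.1 j) : ℝ))|}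
    (fun g => ?_) fun x => edgeLaw_abs_sum_ge_le hn hT (fun i j => w (x i) (x j)) A A' hτ
  have := fun i j => measurable_graphon_label hw (n := n) i j
  refine measurableSet_le (measurable_const (a := τ)) (g := fun x : Fin n → I =>
    |∑ i ∈ A, ∑ j ∈ A', ∑ t, (entry (g t i j) - (w (x i) (x j) : ℝ))|) ?_
  fun_prop

theorem IsGraphonSample.ae_label_mem (hw : Measurable (Function.uncurry w))
    (h : IsGraphonSample w P u G) {C : Finset (Set I)} (hC : ∀ Q ∈ C, MeasurableSet Q)
    (hae : ∀ᵐ x : I, ∃ Q ∈ C, x ∈ Q) : P {ω | ∃ k, ∀ Q ∈ C, u ω k ∉ Q} = 0 := by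
  have hmeas : MeasurableSet (⋃ Q ∈ C, Q)ᶜ := (C.measurableSet_biUnion fun Q hQ => hC Q hQ).compl
  refine le_antisymm ((h.measure_label_le hw {x | ∃ k, ∀ Q ∈ C, x k ∉ Q} ?_).trans_eq ?_) bot_le
  · have e : {x : Fin n → I | ∃ k, ∀ Q ∈ C, x k ∉ Q} =
        ⋃ k, (fun x => x k) ⁻¹' (⋃ Q ∈ C, Q)ᶜ := by
      ext; simp
    rw [e]
    exact MeasurableSet.iUnion fun k => measurable_pi_apply k hmeas
  · have : ∀ᵐ x : Fin n → I, ∀ k, ∃ Q ∈ C, x k ∈ Q := by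
      refine ae_all_iff.2 fun k => ?_
      rw [volume_pi]
      exact (Measure.quasiMeasurePreserving_eval (fun _ : Fin n => (volume : Measure I)) k).ae hae
    rw [ae_iff] at this
    simpa using this

/-- Non-asymptotic bound for the probability of a large error. -/
theorem measure_mae_gt_le [IsProbabilityMeasure P] (hw : Measurable (Function.uncurry w))
    {K : ℕ} {α : Fin (K + 1) → I} {L : ℝ} (hLip : LipschitzOnPieces α L w) (hL : 0 ≤ L)
    (hn : 0 < n) (hT : 0 < T) {S : ℕ} (hS : 0 < S) (h : IsGraphonSample w P u G)
    {N : Ω → Fin n → Fin n → Finset (Fin n)} (hN : IsNeighborhoodChoice S P u G N)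
    {Δ h₁ h₂ m₀ η τ : ℝ} (hB : IsRandomGreedyOutput Δ G N B)
    (hη : 0 < η) (hLh : L * h₁ ≤ η / 4) (hLh' : L ^ 2 * h₂ ^ 2 ≤ Δ ^ 2 / 2)
    (hΔ : 3 / 2 * Δ ^ 2 ≤ m₀ * η ^ 2 / 16) (hτ : 0 ≤ τ) (hm₀ : 0 ≤ m₀)
    {C C' : Finset (Set I)}
    (hC : ∀ Q ∈ C, MeasurableSet Q ∧ m₀ ≤ volume.real Q ∧ IsCell α h₁ Q)
    (hC' : ∀ Q ∈ C', MeasurableSet Q ∧ IsCell α h₂ Q)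
    (hae : ∀ᵐ x : I, ∃ Q ∈ C, x ∈ Q) (hae' : ∀ᵐ x : I, ∃ Q ∈ C', x ∈ Q) :
    P {ω | 4 * η + τ / (2 * T) * (C'.card : ℝ) ^ 2 / (n : ℝ) ^ 2 < mae w (u ω) (G ω) (B ω)} ≤
      ENNReal.ofReal ((n : ℝ) ^ 2 * (2 * Real.exp (-(S * (Δ ^ 2 / 2) ^ 2 / 2)))
        + (n : ℝ) ^ 2 * C.card * (2 * Real.exp (-(S * m₀ ^ 2 / 2)))
        + 4 ^ n * (2 * Real.exp (-τ ^ 2 / (T * (n : ℝ) ^ 2)))) := by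
  let E₁ : (Fin n → Fin n → Finset (Fin n)) → Set ((Fin n → I) × Obs n T) := fun ν =>
    {z | ∃ q : {q : Fin n × Fin n // q.1 ≠ q.2}, Δ ^ 2 / 2 ≤
      |dHat z.2 ν q.1.1 q.1.2 - sliceDist (fun i j => w (z.1 i) (z.1 j)) ν q.1.1 q.1.2|}
  let E₂ : (Fin n → Fin n → Finset (Fin n)) → Set ((Fin n → I) × Obs n T) := fun ν =>
    {z | ∃ q : {q : Fin n × Fin n // q.1 ≠ q.2} × C,
      ∑ k ∈ ν q.1.1.1 q.1.1.2, (q.2 : Set I).indicator 1 (z.1 k)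
        ≤ (ν q.1.1.1 q.1.1.2).card * m₀ / 2}
  -- All pairs of vertex sets are included, as the blocks are random and depend on the edges.
  let E₃ : Set ((Fin n → I) × Obs n T) :=
    {z | ∃ q : Finset (Fin n) × Finset (Fin n), τ ≤
      |∑ i ∈ q.1, ∑ j ∈ q.2, ∑ t, (entry (z.2 t i j) - (w (z.1 i) (z.1 j) : ℝ))|}
  have hwm := fun i j => measurable_graphon_label hw (n := n) i j
  have hcardq : (Fintype.card {q : Fin n × Fin n // q.1 ≠ q.2} : ℝ) ≤ (n : ℝ) ^ 2 := by
    have := Fintype.card_subtype_le fun q : Fin n × Fin n => q.1 ≠ q.2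
    rw [Fintype.card_prod, Fintype.card_fin] at this
    rw [sq]
    exact_mod_cast this
  have hE : P {ω | (u ω, G ω) ∈ E₁ (N ω) ∪ E₂ (N ω) ∪ E₃} ≤
      ENNReal.ofReal ((n : ℝ) ^ 2 * (2 * Real.exp (-(S * (Δ ^ 2 / 2) ^ 2 / 2)))
        + (n : ℝ) ^ 2 * C.card * (2 * Real.exp (-(S * m₀ ^ 2 / 2)))
        + 4 ^ n * (2 * Real.exp (-τ ^ 2 / (T * (n : ℝ) ^ 2)))) := by
    refine hN.measure_le (fun ν => E₁ ν ∪ E₂ ν ∪ E₃) (fun ν g => ?_) fun ν hν hνS => ?_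
    · refine MeasurableSet.union (MeasurableSet.union ?_ ?_) ?_
      · refine MeasurableSet.congr (MeasurableSet.iUnion
          fun q : {q : Fin n × Fin n // q.1 ≠ q.2} => measurableSet_le
          (measurable_const (a := Δ ^ 2 / 2)) (g := fun x : Fin n → I => |dHat g ν q.1.1 q.1.2 -
            sliceDist (fun i j => w (x i) (x j)) ν q.1.1 q.1.2|) ?_) ?_
        · unfold sliceDist
          fun_prop
        · exact Set.ext fun x => Set.mem_iUnion
      · have hQ : ∀ Q : C, Measurable ((Q : Set I).indicator (1 : I → ℝ)) := fun Q =>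
          measurable_one.indicator (hC Q Q.2).1
        refine MeasurableSet.congr (MeasurableSet.iUnion
          fun q : {q : Fin n × Fin n // q.1 ≠ q.2} × C => measurableSet_le
          (f := fun x : Fin n → I => ∑ k ∈ ν q.1.1.1 q.1.1.2, (q.2 : Set I).indicator 1 (x k))
          ?_ (measurable_const (a := (ν q.1.1.1 q.1.1.2).card * m₀ / 2))) ?_
        · have := hQ q.2
          fun_prop
        · exact Set.ext fun x => Set.mem_iUnion
      · refine MeasurableSet.congr (MeasurableSet.iUnion
          fun q : Finset (Fin n) × Finset (Fin n) => measurableSet_le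
          (measurable_const (a := τ)) (g := fun x : Fin n → I =>
            |∑ i ∈ q.1, ∑ j ∈ q.2, ∑ t, (entry (g t i j) - (w (x i) (x j) : ℝ))|) ?_) ?_
        · fun_prop
        · exact Set.ext fun x => Set.mem_iUnion
    · rw [ENNReal.ofReal_add (by positivity) (by positivity),
        ENNReal.ofReal_add (by positivity) (by positivity)]
      refine (measure_union_le _ _).trans (add_le_add ((measure_union_le _ _).trans
        (add_le_add ?_ ?_)) ?_)
      · refine (measure_exists_le_card_mul fun q : {q : Fin n × Fin n // q.1 ≠ q.2} =>
          h.measure_dHat_deviation_le hw hT hS hν hνS (by positivity) q.2).trans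
          (ENNReal.ofReal_le_ofReal ?_)
        gcongr
      · refine (measure_exists_le_card_mul
          (A := fun q : {q : Fin n × Fin n // q.1 ≠ q.2} × C => {ω |
            ∑ k ∈ ν q.1.1.1 q.1.1.2, (q.2 : Set I).indicator 1 (u ω k)
              ≤ (ν q.1.1.1 q.1.1.2).card * m₀ / 2})
          (r := 2 * Real.exp (-(S * m₀ ^ 2 / 2))) fun q => ?_).trans (ENNReal.ofReal_le_ofReal ?_)
        · have := h.measure_count_le hw (ν q.1.1.1 q.1.1.2) (by rw [hνS _ _ q.1.2]; exact hS)
            (hC q.2 q.2.2).1 hm₀ (hC q.2 q.2.2).2.1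
          rwa [hνS _ _ q.1.2] at this ⊢
        · rw [Fintype.card_prod, Fintype.card_coe, Nat.cast_mul]
          gcongr
      · refine (measure_exists_le_card_mul fun q : Finset (Fin n) × Finset (Fin n) =>
          h.measure_edge_deviation_le hw hn hT q.1 q.2 hτ).trans_eq ?_
        rw [Fintype.card_prod, Fintype.card_finset, Fintype.card_fin, ← mul_pow]
        norm_num
  have hZ := h.ae_label_mem hw (fun Q hQ => (hC Q hQ).1) hae
  have hZ' := h.ae_label_mem hw (fun Q hQ => (hC' Q hQ).1) hae'
  have hsub : {ω | 4 * η + τ / (2 * T) * (C'.card : ℝ) ^ 2 / (n : ℝ) ^ 2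
        < mae w (u ω) (G ω) (B ω)} ⊆
      {ω | (u ω, G ω) ∈ E₁ (N ω) ∪ E₂ (N ω) ∪ E₃} ∪
        ({ω | ∃ k, ∀ Q ∈ C, u ω k ∉ Q} ∪ {ω | ∃ k, ∀ Q ∈ C', u ω k ∉ Q}) := by
    intro ω hω
    by_contra hcon
    simp only [Set.mem_union, Set.mem_ofPred_eq, not_or, not_exists, not_forall, not_not,
      exists_prop, E₁, E₂, E₃, not_le] at hcon
    obtain ⟨⟨⟨h1, h2⟩, h3⟩, h4, h5⟩ := hcon
    rw [Set.mem_ofPred_eq] at hω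
    refine absurd hω (not_lt.2 ?_)
    exact hLip.mae_le hL hT (hB.run ω) hη hLh hLh' hΔ hτ (fun Q hQ => (hC Q hQ).2.2)
      (fun Q hQ => (hC' Q hQ).2) h4 h5
      (fun i j hij => by rw [hN.card_eq ω i j hij]; exact hS)
      (fun i j hij => (h1 ⟨(i, j), hij⟩).le)
      (fun i j hij Q hQ => h2 (⟨(i, j), hij⟩, ⟨Q, hQ⟩))
      (fun A A' => (h3 (A, A')).le)
  refine (measure_mono hsub).trans ((measure_union_le _ _).trans ?_)
  rw [measure_union_null hZ hZ', add_zero]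
  exact hE

end OneSize

/-! ### Asymptotics of the bounds -/

section Asymptotics

theorem eventually_log_le_mul_pow {Δ : ℕ → ℝ} (hΔ_pos : ∀ n, 0 < Δ n)
    (h : (fun n : ℕ => (Real.log n / n) ^ (1 / 4 : ℝ)) =o[atTop] Δ) {δ : ℝ} (hδ : 0 < δ) :
    ∀ᶠ n : ℕ in atTop, Real.log n ≤ δ * (n * Δ n ^ 4) := by
  have h1 := h.def (Real.rpow_pos_of_pos hδ (1 / 4))
  filter_upwards [h1, eventually_ge_atTop 1] with n hn hn1
  have hn' : (0 : ℝ) < n := by exact_mod_cast hn1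
  have hlog : 0 ≤ Real.log n / n := div_nonneg (Real.log_natCast_nonneg n) hn'.le
  rw [Real.norm_of_nonneg (Real.rpow_nonneg hlog _), Real.norm_of_nonneg (hΔ_pos n).le] at hn
  have h4 := pow_le_pow_left₀ (Real.rpow_nonneg hlog _) hn 4
  have e : ∀ y : ℝ, 0 ≤ y → (y ^ (1 / 4 : ℝ)) ^ 4 = y := fun y hy => by
    rw [← Real.rpow_natCast, ← Real.rpow_mul hy]; norm_num
  rw [mul_pow, e _ hlog, e _ hδ.le, div_le_iff₀ hn'] at h4
  linarith

theorem tendsto_mul_pow_atTop {Δ : ℕ → ℝ} (hΔ_pos : ∀ n, 0 < Δ n)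
    (h : (fun n : ℕ => (Real.log n / n) ^ (1 / 4 : ℝ)) =o[atTop] Δ) :
    Tendsto (fun n : ℕ => (n : ℝ) * Δ n ^ 4) atTop atTop := by
  refine tendsto_atTop_mono' _ ?_ (Real.tendsto_log_atTop.comp tendsto_natCast_atTop_atTop)
  filter_upwards [eventually_log_le_mul_pow hΔ_pos h one_pos] with n hn
  simpa using hn

theorem exists_eventually_mul_le {S : ℕ → ℕ}
    (hS : (fun n : ℕ => (S n : ℝ)) =Θ[atTop] (fun n : ℕ => (n : ℝ))) :
    ∃ c : ℝ, 0 < c ∧ ∀ᶠ n : ℕ in atTop, c * n ≤ S n := by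
  obtain ⟨C, hC, h⟩ := hS.2.exists_pos
  refine ⟨C⁻¹, inv_pos.2 hC, ?_⟩
  filter_upwards [h.bound] with n hn
  rw [Real.norm_natCast, Real.norm_natCast] at hn
  rwa [inv_mul_le_iff₀ hC]

theorem tendsto_sq_mul_exp_neg_mul {a : ℝ} (ha : 0 < a) :
    Tendsto (fun n : ℕ => (n : ℝ) ^ 2 * Real.exp (-(a * n))) atTop (𝓝 0) := by
  have h := ((Real.tendsto_pow_mul_exp_neg_atTop_nhds_zero 2).comp
    (tendsto_natCast_atTop_atTop.const_mul_atTop ha)).const_mul (1 / a ^ 2)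
  rw [mul_zero] at h
  refine h.congr fun n => ?_
  simp only [Function.comp_apply]
  field_simp

/-- Since e² > 4, the tail exp(-2n) beats the union bound over 4ⁿ pairs of vertex sets. -/
theorem tendsto_four_pow_mul_exp :
    Tendsto (fun n : ℕ => (4 : ℝ) ^ n * (2 * Real.exp (-(2 * n)))) atTop (𝓝 0) := by
  have h4 : 4 * Real.exp (-2) < 1 := by
    rw [Real.exp_neg, ← div_eq_mul_inv, div_lt_one (Real.exp_pos _)]
    have h1 := Real.exp_one_gt_d9
    have h2 : Real.exp 2 = Real.exp 1 * Real.exp 1 := by rw [← Real.exp_add]; norm_num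
    nlinarith
  have h := (tendsto_pow_atTop_nhds_zero_of_lt_one (by positivity) h4).const_mul 2
  rw [mul_zero] at h
  refine h.congr fun n => ?_
  rw [mul_pow, ← Real.exp_nat_mul]
  ring_nf

/-- The probability bound of `measure_mae_gt_le` tends to zero. -/
theorem tendsto_probability_bound {T : ℕ} (hT : 0 < T) {S : ℕ → ℕ}
    (hS : (fun n : ℕ => (S n : ℝ)) =Θ[atTop] (fun n : ℕ => (n : ℝ)))
    {Δ : ℕ → ℝ} (hΔ_pos : ∀ n, 0 < Δ n)
    (h : (fun n : ℕ => (Real.log n / n) ^ (1 / 4 : ℝ)) =o[atTop] Δ) {m₀ : ℝ} (hm₀ : 0 < m₀)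
    (M : ℝ) (hM : 0 ≤ M) :
    Tendsto (fun n : ℕ => (n : ℝ) ^ 2 * (2 * Real.exp (-(S n * (Δ n ^ 2 / 2) ^ 2 / 2)))
        + (n : ℝ) ^ 2 * M * (2 * Real.exp (-(S n * m₀ ^ 2 / 2)))
        + 4 ^ n * (2 * Real.exp (-(√(2 * T) * n * √n) ^ 2 / (T * (n : ℝ) ^ 2)))) atTop (𝓝 0) := by
  obtain ⟨c, hc, hcS⟩ := exists_eventually_mul_le hS
  have hT' : (0 : ℝ) < T := by exact_mod_cast hT
  have h1 : Tendsto (fun n : ℕ => (n : ℝ) ^ 2 * (2 * Real.exp (-(S n * (Δ n ^ 2 / 2) ^ 2 / 2))))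
      atTop (𝓝 0) := by
    have hlim : Tendsto (fun n : ℕ => 2 * (1 / (n : ℝ))) atTop (𝓝 0) := by
      simpa using (tendsto_one_div_atTop_nhds_zero_nat (𝕜 := ℝ)).const_mul 2
    refine squeeze_zero' (.of_forall fun n => by positivity) ?_ hlim
    -- The exponent is S Δ⁴/8 ≥ c n Δ⁴/8; the constant c/24 makes this at least 3 log n, one power
    -- more than the n² pairs require.
    filter_upwards [hcS, eventually_log_le_mul_pow hΔ_pos h (by positivity : 0 < c / 24),
      eventually_ge_atTop 1] with n hn hlog hn1
    have hn' : (0 : ℝ) < n := by exact_mod_cast hn1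
    have hexp : Real.exp (-(S n * (Δ n ^ 2 / 2) ^ 2 / 2)) ≤ 1 / (n : ℝ) ^ 3 := by
      have e : 1 / (n : ℝ) ^ 3 = Real.exp (-(3 * Real.log n)) := by
        rw [Real.exp_neg, one_div, ← Real.exp_log hn', ← Real.exp_nat_mul, Real.log_exp]
        norm_num
      rw [e, Real.exp_le_exp, neg_le_neg_iff]
      have := mul_le_mul_of_nonneg_right hn (pow_nonneg (hΔ_pos n).le 4)
      nlinarith
    calc (n : ℝ) ^ 2 * (2 * Real.exp (-(S n * (Δ n ^ 2 / 2) ^ 2 / 2)))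
        ≤ (n : ℝ) ^ 2 * (2 * (1 / (n : ℝ) ^ 3)) := by gcongr
      _ = 2 * (1 / (n : ℝ)) := by field_simp
  have h2 : Tendsto (fun n : ℕ => (n : ℝ) ^ 2 * M * (2 * Real.exp (-(S n * m₀ ^ 2 / 2))))
      atTop (𝓝 0) := by
    have hlim := (tendsto_sq_mul_exp_neg_mul (by positivity : 0 < c * m₀ ^ 2 / 2)).const_mul (2 * M)
    rw [mul_zero] at hlim
    refine squeeze_zero' (.of_forall fun n => by positivity) ?_ hlim
    filter_upwards [hcS] with n hn
    have : Real.exp (-(S n * m₀ ^ 2 / 2)) ≤ Real.exp (-(c * m₀ ^ 2 / 2 * n)) := by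
      rw [Real.exp_le_exp, neg_le_neg_iff]
      nlinarith [sq_nonneg m₀]
    calc (n : ℝ) ^ 2 * M * (2 * Real.exp (-(S n * m₀ ^ 2 / 2)))
        ≤ (n : ℝ) ^ 2 * M * (2 * Real.exp (-(c * m₀ ^ 2 / 2 * n))) := by gcongr
      _ = _ := by ring
  have h3 : Tendsto (fun n : ℕ => (4 : ℝ) ^ n *
      (2 * Real.exp (-(√(2 * T) * n * √n) ^ 2 / (T * (n : ℝ) ^ 2)))) atTop (𝓝 0) := by
    refine tendsto_four_pow_mul_exp.congr' ?_
    filter_upwards [eventually_ge_atTop 1] with n hn1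
    have hn' : (0 : ℝ) < n := by exact_mod_cast hn1
    congr 3
    rw [mul_pow, mul_pow, Real.sq_sqrt (by positivity), Real.sq_sqrt hn'.le]
    field_simp
  simpa using (h1.add h2).add h3

/-- Since c = O(1/Δ), the left side is O(1/(√n Δ²)), and (√n Δ²)² = n Δ⁴ is assumed large. -/
theorem noise_error_le {L ε Δ t c : ℝ} {n K : ℕ} (hn : 0 < n) (hL : 0 < L) (ht : 0 ≤ t)
    (hε : 0 < ε) (hΔ : 0 < Δ) (hΔ1 : Δ ≤ 1) (hc : 0 ≤ c) (hcK : c ≤ K * (1 / (Δ / (2 * L)) + 1))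
    (hbig : (t * (K * (2 * L + 1)) ^ 2 / ε) ^ 2 ≤ n * Δ ^ 4) :
    t * n * √n * c ^ 2 / (n : ℝ) ^ 2 ≤ ε := by
  have hn' : (0 : ℝ) < n := by exact_mod_cast hn
  have hs : 0 < √(n : ℝ) := Real.sqrt_pos.2 hn'
  have hs2 : √(n : ℝ) ^ 2 = n := Real.sq_sqrt hn'.le
  have hcΔ : c * Δ ≤ K * (2 * L + 1) := by
    have h1 := mul_le_mul_of_nonneg_right hcK hΔ.le
    have h2 : K * (1 / (Δ / (2 * L)) + 1) * Δ = K * (2 * L + Δ) := by field_simp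
    rw [h2] at h1
    exact h1.trans (by gcongr)
  have hsq := pow_le_pow_left₀ (mul_nonneg hc hΔ.le) hcΔ 2
  have hroot : t * (K * (2 * L + 1)) ^ 2 / ε ≤ √n * Δ ^ 2 := by
    refine (pow_le_pow_iff_left₀ (by positivity) (by positivity) two_ne_zero).1 (hbig.trans_eq ?_)
    rw [mul_pow, hs2]; ring
  rw [div_le_iff₀ hε] at hroot
  have h3 : t * (c * Δ) ^ 2 ≤ √n * Δ ^ 2 * ε := (mul_le_mul_of_nonneg_left hsq ht).trans hroot
  have h4 : t * c ^ 2 ≤ √n * ε := by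
    refine le_of_mul_le_mul_right ?_ (pow_pos hΔ 2)
    linarith
  rw [div_le_iff₀ (by positivity)]
  calc t * n * √n * c ^ 2 = (t * c ^ 2) * (n * √n) := by ring
    _ ≤ (√n * ε) * (n * √n) := by gcongr
    _ = ε * n * √n ^ 2 := by ring
    _ = ε * n ^ 2 := by rw [hs2]; ring

end Asymptotics

/-! ### Convergence in probability and in mean -/

/-- The mean absolute error tends to zero in probability. -/
theorem eventually_measure_mae_gt_le
    {w : I → I → I} (hw_meas : Measurable (Function.uncurry w)) (hw : IsPiecewiseLipschitz w)
    {T : ℕ} (hT : 0 < T) {S : ℕ → ℕ}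
    (hS : (fun n : ℕ => (S n : ℝ)) =Θ[atTop] (fun n : ℕ => (n : ℝ)))
    {Δ : ℕ → ℝ} (hΔ_pos : ∀ n, 0 < Δ n)
    (hΔ_omega : (fun n : ℕ => (Real.log n / n) ^ (1 / 4 : ℝ)) =o[atTop] Δ)
    (hΔ_o : Δ =o[atTop] (fun _ : ℕ => (1 : ℝ)))
    {Ω : ℕ → Type*} [∀ n, MeasurableSpace (Ω n)]
    {P : ∀ n, Measure (Ω n)} [∀ n, IsProbabilityMeasure (P n)]
    {u : ∀ n, Ω n → Fin n → I} {G : ∀ n, Ω n → Obs n T}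
    (hsample : ∀ n, IsGraphonSample w (P n) (u n) (G n))
    {N : ∀ n, Ω n → Fin n → Fin n → Finset (Fin n)}
    (hN : ∀ n, IsNeighborhoodChoice (S n) (P n) (u n) (G n) (N n))
    {B : ∀ n, Ω n → List (Finset (Fin n))}
    (hB : ∀ n, IsRandomGreedyOutput (Δ n) (G n) (N n) (B n)) {ε : ℝ} (hε : 0 < ε) :
    ∀ᶠ n in atTop, (P n) {ω | ε < mae w (u n ω) (G n ω) (B n ω)} ≤ ENNReal.ofReal ε := by
  obtain ⟨K, α, L, -, h0, h1, hL, hLip⟩ := hw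
  -- With η = ε/8 the bias 4η takes ε/2 and leaves ε/2 for the noise.
  have hη : 0 < ε / 8 := by positivity
  have hh : 0 < ε / 8 / (4 * L) := by positivity
  -- These cells do not depend on n, so `m₀` stays fixed while Δ tends to 0; the cells `C'` below
  -- shrink with Δ and only their number matters.
  obtain ⟨C, m₀, hm₀, -, hC, hae⟩ := exists_cells h0 h1 hh
  obtain ⟨c, hc, hcS⟩ := exists_eventually_mul_le hS
  have hT' : (0 : ℝ) < T := by exact_mod_cast hT
  have hΔ0 : Tendsto Δ atTop (𝓝 0) := (isLittleO_one_iff ℝ).1 hΔ_o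
  have hΔsq : Tendsto (fun n => 3 / 2 * Δ n ^ 2) atTop (𝓝 0) := by
    simpa using (hΔ0.pow 2).const_mul (3 / 2)
  filter_upwards [hcS, eventually_gt_atTop 0, hΔ0.eventually_le_const one_pos,
    hΔsq.eventually_le_const (by positivity : 0 < m₀ * (ε / 8) ^ 2 / 16),
    (tendsto_probability_bound hT hS hΔ_pos hΔ_omega hm₀ C.card
      (by positivity)).eventually_le_const hε,
    (tendsto_mul_pow_atTop hΔ_pos hΔ_omega).eventually_ge_atTop
      ((√(2 * T) / (2 * T) * (K * (2 * L + 1)) ^ 2 / (ε / 2)) ^ 2)]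
    with n hnS hn hΔ1 hΔ2 hprob hbig
  have hn' : (0 : ℝ) < n := by exact_mod_cast hn
  have hSpos : 0 < S n := by
    have : (0 : ℝ) < S n := (mul_pos hc hn').trans_le hnS
    exact_mod_cast this
  have hh' : 0 < Δ n / (2 * L) := div_pos (hΔ_pos n) (by positivity)
  obtain ⟨C', m₁, -, hcard, hC', hae'⟩ := exists_cells h0 h1 hh'
  have hnoise := noise_error_le hn hL (by positivity : 0 ≤ √(2 * T) / (2 * T)) (half_pos hε)
    (hΔ_pos n) hΔ1 (Nat.cast_nonneg C'.card) hcard hbig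
  -- The choice τ = √(2T) n √n gives τ²/(T n²) = 2n, the exponent set against 4ⁿ.
  have hmain := measure_mae_gt_le hw_meas hLip hL.le hn hT hSpos (hsample n) (hN n) (hB n) hη
    (h₁ := ε / 8 / (4 * L)) (by field_simp; rfl) (h₂ := Δ n / (2 * L))
    (by
      have : L ^ 2 * (Δ n / (2 * L)) ^ 2 = Δ n ^ 2 / 4 := by field_simp; norm_num
      rw [this]; nlinarith [sq_nonneg (Δ n)])
    hΔ2 (τ := √(2 * T) * n * √n) (by positivity) hm₀.le hC
    (fun Q hQ => ⟨(hC' Q hQ).1, (hC' Q hQ).2.2⟩) hae hae'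
  refine (measure_mono fun ω hω => ?_).trans (hmain.trans (ENNReal.ofReal_le_ofReal hprob))
  rw [Set.mem_ofPred_eq] at hω ⊢
  refine lt_of_le_of_lt ?_ hω
  have e : √(2 * T) * n * √n / (2 * T) * (C'.card : ℝ) ^ 2 / (n : ℝ) ^ 2 =
      √(2 * T) / (2 * T) * n * √n * (C'.card : ℝ) ^ 2 / (n : ℝ) ^ 2 := by ring
  rw [e]
  linarith

/-- A random variable with values in `[0, 1]` has small mean if it is small with high
probability. -/
theorem integral_le_of_measure_gt_le {Ω : Type*} [MeasurableSpace Ω] {μ : Measure Ω}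
    [IsProbabilityMeasure μ] {f : Ω → ℝ} (hf : Measurable f) (h0 : ∀ ω, 0 ≤ f ω)
    (h1 : ∀ ω, f ω ≤ 1) {ε : ℝ} (hε : 0 < ε) (h : μ {ω | ε < f ω} ≤ ENNReal.ofReal ε) :
    ∫ ω, f ω ∂μ ≤ 2 * ε := by
  have hA : MeasurableSet {ω | ε < f ω} := measurableSet_lt measurable_const hf
  have hint : Integrable f μ := .of_mem_Icc 0 1 hf.aemeasurable (ae_of_all _ fun ω => ⟨h0 ω, h1 ω⟩)
  have hind : Integrable ({ω | ε < f ω}.indicator (1 : Ω → ℝ)) μ :=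
    (integrable_const (1 : ℝ)).indicator hA
  have hle : ∀ ω, f ω ≤ ε + {ω | ε < f ω}.indicator (1 : Ω → ℝ) ω := by
    intro ω
    by_cases hω : ε < f ω
    · rw [Set.indicator_of_mem (by exact hω), Pi.one_apply]
      linarith [h1 ω]
    · rw [Set.indicator_of_notMem (by exact hω)]
      linarith
  refine (integral_mono hint ((integrable_const ε).add hind) hle).trans ?_
  simp only [Pi.add_apply]
  rw [integral_add (integrable_const ε) hind, integral_indicator_one hA, integral_const,
    probReal_univ, one_smul]
  have : μ.real {ω | ε < f ω} ≤ ε := ENNReal.toReal_le_of_le_ofReal hε.le h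
  linarith

end SBA

theorem theorem3
    (w : I → I → I) (hw_meas : Measurable (Function.uncurry w))
    (hw : SBA.IsPiecewiseLipschitz w)
    (T : ℕ) (hT : 0 < T)
    (S : ℕ → ℕ) (hS : (fun n : ℕ => (S n : ℝ)) =Θ[atTop] (fun n : ℕ => (n : ℝ)))
    (Δ : ℕ → ℝ) (hΔ_pos : ∀ n, 0 < Δ n)
    (hΔ_omega : (fun n : ℕ => (Real.log n / n) ^ (1 / 4 : ℝ)) =o[atTop] Δ)
    (hΔ_o : Δ =o[atTop] (fun _ : ℕ => (1 : ℝ)))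
    {Ω : ℕ → Type*} [∀ n, MeasurableSpace (Ω n)]
    (P : ∀ n, Measure (Ω n)) [∀ n, IsProbabilityMeasure (P n)]
    (u : ∀ n, Ω n → Fin n → I) (G : ∀ n, Ω n → SBA.Obs n T)
    (hsample : ∀ n, SBA.IsGraphonSample w (P n) (u n) (G n))
    (N : ∀ n, Ω n → Fin n → Fin n → Finset (Fin n))
    (hN : ∀ n, SBA.IsNeighborhoodChoice (S n) (P n) (u n) (G n) (N n))
    (B : ∀ n, Ω n → List (Finset (Fin n)))
    (hB : ∀ n, SBA.IsRandomGreedyOutput (Δ n) (G n) (N n) (B n)) :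
    ((∀ n, Integrable (fun ω => SBA.mae w (u n ω) (G n ω) (B n ω)) (P n)) ∧
      Tendsto (fun n => ∫ ω, SBA.mae w (u n ω) (G n ω) (B n ω) ∂(P n)) atTop (𝓝 0)) ∧
    ((∀ n, Integrable (fun ω => SBA.mse w (u n ω) (G n ω) (B n ω)) (P n)) ∧
      Tendsto (fun n => ∫ ω, SBA.mse w (u n ω) (G n ω) (B n ω) ∂(P n)) atTop (𝓝 0)) := by
  have hmae := fun n => SBA.measurable_mae hw_meas (hsample n) (hB n).measurableSet_eq
  have hmse := fun n => SBA.measurable_mse hw_meas (hsample n) (hB n).measurableSet_eq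
  have hmaei : ∀ n, Integrable (fun ω => SBA.mae w (u n ω) (G n ω) (B n ω)) (P n) := fun n =>
    .of_mem_Icc 0 1 (hmae n).aemeasurable
      (ae_of_all _ fun ω => ⟨SBA.mae_nonneg _ _ _, SBA.mae_le_one _ _ _⟩)
  have hmsei : ∀ n, Integrable (fun ω => SBA.mse w (u n ω) (G n ω) (B n ω)) (P n) := fun n =>
    .of_mem_Icc 0 1 (hmse n).aemeasurable (ae_of_all _ fun ω =>
      ⟨SBA.mse_nonneg _ _ _, (SBA.mse_le_mae _ _ _).trans (SBA.mae_le_one _ _ _)⟩)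
  have hlim : Tendsto (fun n => ∫ ω, SBA.mae w (u n ω) (G n ω) (B n ω) ∂(P n)) atTop (𝓝 0) := by
    rw [Metric.tendsto_atTop']
    intro ε hε
    obtain ⟨n₀, hn₀⟩ := eventually_atTop.1 (SBA.eventually_measure_mae_gt_le hw_meas hw hT hS
      hΔ_pos hΔ_omega hΔ_o hsample hN hB (by positivity : 0 < ε / 4))
    refine ⟨n₀, fun n hn => ?_⟩
    have h := SBA.integral_le_of_measure_gt_le (hmae n) (fun ω => SBA.mae_nonneg _ _ _)
      (fun ω => SBA.mae_le_one _ _ _) (by positivity) (hn₀ n hn.le)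
    rw [Real.dist_eq, sub_zero, abs_of_nonneg (integral_nonneg fun ω => SBA.mae_nonneg _ _ _)]
    linarith
  exact ⟨⟨hmaei, hlim⟩, hmsei, squeeze_zero (fun n => integral_nonneg fun ω => SBA.mse_nonneg _ _ _)
    (fun n => integral_mono (hmsei n) (hmaei n) fun ω => SBA.mse_le_mae _ _ _) hlim⟩
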